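/- Setting. Let $N,n\ge1$ and $d\ge1$ be integers, $x_0\in\mathbb R^n$, and let all random objects live on one probability space. Node $i\in\mathcal V=\{1,\dots,N\}$ measures $z_i(k)=H_i(k)x_0+v_i(k)\in\mathbb R^{n_i}$, $k\ge0$, with random matrices $H_i(k)\in\mathbb R^{n_i\times n}$ and noises $v_i(k)$; put $v(k)=[v_1^T(k),\dots,v_N^T(k)]^T$. The random weighted adjacency matrix at time $k$ is $\mathcal A_{\mathcal G(k)}=[a_{ij}(k)]\in\mathbb R^{N\times N}$, with $a_{ii}(k)=0$ a.s., and $\mathcal N_i(k)=\{j: a_{ij}(k)\neq0\}$. The delay of the link from $j$ to $i$ is a random variable $\lambda_{ji}(k)\in\{0,\dots,d\}$, with $\lambda_{ii}(k)=0$ a.s. For real gains $a(k),b(k)$, and for arbitrary deterministic initial estimates $x_i(k)\in\mathbb R^n$, $-d\le k\le0$, the algorithm is $$x_i(k+1)=x_i(k)+a(k)H_i^T(k)\big(z_i(k)-H_i(k)x_i(k)\big)+b(k)\sum_{j\in\mathcal N_i(k)}a_{ij}(k)\big(x_j(k-\lambda_{ji}(k))-x_i(k)\big),\quad i\in\mathcal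 V,\ k\ge0 .$$ Notation. $\mathcal F(k)$ is the $\sigma$-field generated by $\mathcal A_{\mathcal G(s)},v(s),H_i(s),\lambda_{ji}(s)$, $i,j\in\mathcal V$, $0\le s\le k$, and $\mathcal F(-1)$ is trivial. $\|\cdot\|$ is the 2-norm, $\circ$ the Hadamard and $\otimes$ the Kronecker product, and $\lambda_{\min}$ the minimum eigenvalue of a real symmetric matrix. Let $\mathcal H(k)=\mathrm{diag}\{H_1(k),\dots,H_N(k)\}$, $\mathcal D_{\mathcal G(k)}=\mathrm{diag}\big(\sum_ja_{1j}(k),\dots,\sum_ja_{Nj}(k)\big)$, $\mathcal L_{\mathcal G(k)}=\mathcal D_{\mathcal G(k)}-\mathcal A_{\mathcal G(k)}$, $\widehat{\mathcal L}_{\mathcal G(k)}=\frac12\big(\mathcal L_{\mathcal G(k)}+\mathcal L_{\mathcal G(k)}^T\big)$. For $0\le q\le d$ let $\mathcal I(k,q)$ be the delay matrix whose entry in row $i$, column $j$ is $1$ if $\lambda_{ji}(k)=q$ and $0$ otherwise, and let $\overline A(k,q)=(\mathcal A_{\mathcal G(k)}\circ\mathcal I(k,q))\otimes I_n$. The matrices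 $F(k)$ (and $C_1(k),\dots,C_d(k)$) are determined recursively by $F(k)=I_{Nn}$ for $k<0$ and, for $k\ge0$, by $$F(k)+C_1(k)=I_{Nn}-b(k)\mathcal D_{\mathcal G(k)}\otimes I_n-a(k)\mathcal H^T(k)\mathcal H(k)+b(k)\overline A(k,0),$$ $$C_q(k)F(k-q)-C_{q+1}(k)=-b(k)\overline A(k,q)\ (1\le q<d),\qquad C_d(k)F(k-d)=-b(k)\overline A(k,d)$$ (under the assumptions below all $F(k)$ are a.s. invertible, so that this determines them a.s.). Let $\Phi_F(j,i)=F(j)\cdots F(i)$ if $j\ge i$ and $\Phi_F(j,i)=I_{Nn}$ if $j<i$. For integers $h\ge1$ and $m\ge0$ let $$\begin{aligned}{\lambda_m^h}'=\lambda_{\min}\Bigg[\sum_{k=mh}^{(m+1)h-1}\Bigg(&2\frac{b(k)}{a(k)}\mathbb E[\widehat{\mathcal L}_{\mathcal G(k)}|\mathcal F(mh-1)]\otimes I_n+2\,\mathbb E[\mathcal H^T(k)\mathcal H(k)|\mathcal F(mh-1)]\\&-\frac{b(k)}{a(k)}\sum_{q=0}^d\mathbb E\big[\overline A(k,q)\big([\Phi_F(k-1,k-q)]^{-1}-I_{Nn}\big)\big|\mathcal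 F(mh-1)\big]\\&-\frac{b(k)}{a(k)}\sum_{q=0}^d\mathbb E\big[\big([\Phi_F(k-1,k-q)]^{-1}-I_{Nn}\big)^T\overline A^T(k,q)\big|\mathcal F(mh-1)\big]\Bigg)\Bigg].\end{aligned}$$ Assumptions. A1.a: the process $\{v(k),k\ge0\}$ is independent of the joint process $\{(H_i(k),\mathcal A_{\mathcal G(k)},\lambda_{ji}(k))_{i,j\in\mathcal V},k\ge0\}$. A1.b: $\{v(k),\mathcal F(k),k\ge0\}$ is a martingale difference sequence, and there is a constant $\beta_v>0$ with $\sup_{k\ge0}\mathbb E[\|v(k)\|^2|\mathcal F(k-1)]\le\beta_v$ a.s. A2.b: there are constants $\beta_a,\beta_H>0$ with $\max_{i,j}\sup_{k\ge0}|a_{ij}(k)|\le\beta_a$ a.s. and $\max_i\sup_{k\ge0}\|H_i(k)\|\le\beta_H$ a.s. A3.a: $\{a(k)\}$ and $\{b(k)\}$ are positive, monotonically decreasing to zero, $a(k)=O(b(k))$, $a(k)=O(a(k+m))$ for every integer $m\ge1$, $b^2(k)=o(a(k))$, and $\sum_{k=0}^\infty a(k)=\infty$. A3.c: with a constant $C_a$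 such that $a(k)\le C_ab(k)$ for all $k\ge0$, $$\sup_{k\ge0}b(k)<\sup_{0<\kappa<1}\min\left\{\frac{\kappa}{2[N\beta_a+N\sqrt N\beta_a+C_a\beta_H^2]},\ \frac{(1-(1-\kappa)^{-1})\kappa}{2N\sqrt N\beta_a(1-(1-\kappa)^{-(d+1)})}\right\}.$$ Theorem. Suppose that A1.a, A1.b, A2.b, A3.a and A3.c hold, and that there are an integer $h\ge1$ and a constant $\theta>0$ such that $\inf_{m\ge0}{\lambda_m^h}'\ge\theta$ a.s. Then the algorithm converges in mean square: for every $i\in\mathcal V$, $\mathbb E\|x_i(k)-x_0\|^2<\infty$ for all $k\ge0$, and $\lim_{k\to\infty}\mathbb E\|x_i(k)-x_0\|^2=0$. -/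

import Mathlib

open MeasureTheory ProbabilityTheory Filter Topology Asymptotics
open scoped Matrix Kronecker

noncomputable section

namespace DistEst

/-! ### General matrix notions -/

/-- Minimum eigenvalue of a real symmetric matrix (its real spectrum is a finite set). -/
def lambdaMin {ι : Type*} [Fintype ι] [DecidableEq ι] (S : Matrix ι ι ℝ) : ℝ :=
  sInf (spectrum ℝ S)

/-- Entrywise conditional expectation of a random matrix. -/
def condExpMat {Ω : Type*} [mΩ : MeasurableSpace Ω] {ι κ : Type*} (μ : Measure Ω)
    (m : MeasurableSpace Ω) (Z : Ω → Matrix ι κ ℝ) (ω : Ω) : Matrix ι κ ℝ :=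
  Matrix.of fun i j => (μ[fun ω' => Z ω' i j | m]) ω

/-- `prodFrom Z i l = Z (i + l - 1) * ⋯ * Z (i + 1) * Z i` (`l` factors). -/
def prodFrom {ι : Type*} [Fintype ι] [DecidableEq ι] (Z : ℤ → Matrix ι ι ℝ) (i : ℤ) :
    ℕ → Matrix ι ι ℝ
  | 0 => 1
  | l + 1 => Z (i + l) * prodFrom Z i l

/-- `Phi Z j i = Z j * ⋯ * Z i` if `i ≤ j`, and the identity if `j < i`. -/
def Phi {ι : Type*} [Fintype ι] [DecidableEq ι] (Z : ℤ → Matrix ι ι ℝ) (j i : ℤ) :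
    Matrix ι ι ℝ :=
  prodFrom Z i (j + 1 - i).toNat

/-! ### The network, the measurements, the delays -/

/-- The random data of a network of `N` nodes that estimate a parameter in `ℝⁿ`, with delays in
`{0, …, d}`. Indices of nodes are elements of `Fin N`. -/
structure Network (Ω : Type*) [MeasurableSpace Ω] (μ : Measure Ω) (N n d : ℕ) where
  /-- dimension of the measurement of each node -/
  p : Fin N → ℕ
  /-- the unknown parameter -/
  x₀ : EuclideanSpace ℝ (Fin n)
  /-- observation matrices: `H i k ω` is the one of node `i` at time `k` -/
  H : (i : Fin N) → ℕ → Ω → Matrix (Fin (p i)) (Fin n) ℝ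
  /-- stacked measurement noise of all nodes -/
  v : ℕ → Ω → EuclideanSpace ℝ (Σ i : Fin N, Fin (p i))
  /-- weighted adjacency matrices: entry `(i, j)` is the weight of the link from `j` to `i` -/
  A : ℕ → Ω → Matrix (Fin N) (Fin N) ℝ
  /-- `delay k j i` is the delay at time `k` of the link from node `j` to node `i` -/
  delay : ℕ → Fin N → Fin N → Ω → Fin (d + 1)
  /-- innovation gain -/
  a : ℕ → ℝ
  /-- consensus gain -/
  b : ℕ → ℝ
  measurable_H : ∀ i k r c, Measurable fun ω => H i k ω r c
  measurable_v : ∀ k, Measurable (v k)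
  measurable_A : ∀ k i j, Measurable fun ω => A k ω i j
  measurable_delay : ∀ k j i, Measurable (delay k j i)
  A_diag : ∀ k i, ∀ᵐ ω ∂μ, A k ω i i = 0
  delay_diag : ∀ k i, ∀ᵐ ω ∂μ, delay k i i ω = 0

namespace Network

variable {Ω : Type*} [MeasurableSpace Ω] {μ : Measure Ω} {N n d : ℕ} (M : Network Ω μ N n d)

/-- Noise of node `i`. -/
def vNode (i : Fin N) (k : ℕ) (ω : Ω) : Fin (M.p i) → ℝ := fun r => M.v k ω ⟨i, r⟩

/-- Measurement of node `i`: `z_i(k) = H_i(k) x₀ + v_i(k)`. -/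
def z (i : Fin N) (k : ℕ) (ω : Ω) : Fin (M.p i) → ℝ :=
  M.H i k ω *ᵥ M.x₀.ofLp + M.vNode i k ω

open Classical in
/-- The neighbours of node `i` at time `k`. -/
def nbr (i : Fin N) (k : ℕ) (ω : Ω) : Finset (Fin N) :=
  Finset.univ.filter fun j => M.A k ω i j ≠ 0

/-- `x` is the family of estimates produced by the algorithm, with deterministic initial estimates
at the times `-d, …, 0`. Values at times before `-d` play no role. -/
structure IsEstimate (x : Fin N → ℤ → Ω → EuclideanSpace ℝ (Fin n)) : Prop where
  initial : ∃ ξ : Fin N → ℤ → EuclideanSpace ℝ (Fin n),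
    ∀ i (k : ℤ), -(d : ℤ) ≤ k → k ≤ 0 → ∀ ω, x i k ω = ξ i k
  step : ∀ i (k : ℕ) ω,
    x i ((k : ℤ) + 1) ω = x i k ω
      + M.a k • WithLp.toLp 2 ((M.H i k ω)ᵀ *ᵥ (M.z i k ω - M.H i k ω *ᵥ (x i k ω).ofLp))
      + M.b k • ∑ j ∈ M.nbr i k ω,
          M.A k ω i j • (x j ((k : ℤ) - ((M.delay k j i ω : ℕ) : ℤ)) ω - x i k ω)

/-! ### σ-fields -/

/-- σ-field of the graph, the observation matrices and the delays at time `s`. -/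
@[reducible] def sigmaEnv (s : ℕ) : MeasurableSpace Ω :=
  (⨆ i, ⨆ j, MeasurableSpace.comap (fun ω => M.A s ω i j) inferInstance)
    ⊔ (⨆ i, ⨆ r, ⨆ c, MeasurableSpace.comap (fun ω => M.H i s ω r c) inferInstance)
    ⊔ (⨆ j, ⨆ i, MeasurableSpace.comap (M.delay s j i) inferInstance)

/-- σ-field of the noise at time `s`. -/
@[reducible] def sigmaNoise (s : ℕ) : MeasurableSpace Ω :=
  MeasurableSpace.comap (M.v s) inferInstance

/-- `ℱ(k)`: generated by all the data at the times `0 ≤ s ≤ k`; it is trivial for `k = -1`. -/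
@[reducible] def sigmaF (k : ℤ) : MeasurableSpace Ω :=
  ⨆ s : ℕ, ⨆ _ : (s : ℤ) ≤ k, M.sigmaEnv s ⊔ M.sigmaNoise s

/-! ### Compact-form matrices -/

/-- Degree matrix of the graph. -/
def degMat (k : ℕ) (ω : Ω) : Matrix (Fin N) (Fin N) ℝ :=
  Matrix.diagonal fun i => ∑ j, M.A k ω i j

/-- Laplacian matrix of the graph. -/
def lap (k : ℕ) (ω : Ω) : Matrix (Fin N) (Fin N) ℝ := M.degMat k ω - M.A k ω

/-- Symmetrized Laplacian matrix. -/
def symLap (k : ℕ) (ω : Ω) : Matrix (Fin N) (Fin N) ℝ :=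
  (1 / 2 : ℝ) • (M.lap k ω + (M.lap k ω)ᵀ)

/-- `𝓗(k) = diag(H_1(k), …, H_N(k))`; the columns of block `i` are the pairs `(i, c)`. -/
def calH (k : ℕ) (ω : Ω) : Matrix (Σ i : Fin N, Fin (M.p i)) (Fin N × Fin n) ℝ :=
  Matrix.of fun r c => if r.1 = c.1 then M.H r.1 k ω r.2 c.2 else 0

/-- Delay matrix: entry `(i, j)` is `1` if the delay from `j` to `i` equals `q`, and else `0`, in
accordance with the entry `(i, j)` of the adjacency matrix. -/
def delayMat (k q : ℕ) (ω : Ω) : Matrix (Fin N) (Fin N) ℝ :=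
  Matrix.of fun i j => if (M.delay k j i ω : ℕ) = q then 1 else 0

/-- `Ā(k,q)`: Hadamard product of adjacency and delay matrix, tensored with the identity. -/
def Abar (k q : ℕ) (ω : Ω) : Matrix (Fin N × Fin n) (Fin N × Fin n) ℝ :=
  (M.A k ω ⊙ M.delayMat k q ω) ⊗ₖ (1 : Matrix (Fin n) (Fin n) ℝ)

/-! ### The equivalent delay-free system

The matrices `F(k)` and `C_q(k)`, `1 ≤ q ≤ d`, are obtained by solving, at each time `k ≥ 0`,
the equations
`F(k) + C_1(k) = I - b(k) D(k) ⊗ I - a(k) 𝓗(k)ᵀ 𝓗(k) + b(k) Ā(k,0)`,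
`C_q(k) F(k-q) - C_{q+1}(k) = - b(k) Ā(k,q)` for `1 ≤ q < d`,
`C_d(k) F(k-d) = - b(k) Ā(k,d)`
from the last one upwards, starting from `F(k) = I` for `k < 0`. -/

/-- Back substitution: given `P j = F j` for `j < k`, the `t`-th value is `C_{d+1-t}(k)`. -/
def backC (k : ℕ) (ω : Ω) (P : ℤ → Matrix (Fin N × Fin n) (Fin N × Fin n) ℝ) :
    ℕ → Matrix (Fin N × Fin n) (Fin N × Fin n) ℝ
  | 0 => 0
  | t + 1 => (backC k ω P t - M.b k • M.Abar k (d - t) ω) * (P ((k : ℤ) - ((d - t : ℕ) : ℤ)))⁻¹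

/-- `F(k) + C_1(k)`. -/
def sysMat (k : ℕ) (ω : Ω) : Matrix (Fin N × Fin n) (Fin N × Fin n) ℝ :=
  1 - M.b k • (M.degMat k ω ⊗ₖ (1 : Matrix (Fin n) (Fin n) ℝ))
    - M.a k • ((M.calH k ω)ᵀ * M.calH k ω) + M.b k • M.Abar k 0 ω

/-- The sequence that equals `F` at the times before `k`, and `I` from time `k` on. -/
def Fhist (ω : Ω) : ℕ → ℤ → Matrix (Fin N × Fin n) (Fin N × Fin n) ℝ
  | 0 => fun _ => 1
  | k + 1 => Function.update (Fhist ω k) (k : ℤ) (M.sysMat k ω - M.backC k ω (Fhist ω k) d)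

/-- `F(k)`, for all integers `k`. -/
def F (k : ℤ) (ω : Ω) : Matrix (Fin N × Fin n) (Fin N × Fin n) ℝ :=
  M.Fhist ω (k + 1).toNat k

/-- `C_q(k)`, for `k ≥ 0` and `1 ≤ q`; it is zero for `q = 0` and for `q > d`. -/
def C (q k : ℕ) (ω : Ω) : Matrix (Fin N × Fin n) (Fin N × Fin n) ℝ :=
  if q = 0 then 0 else M.backC k ω (fun j => M.F j ω) (d + 1 - q)

theorem F_of_neg {k : ℤ} (hk : k < 0) (ω : Ω) : M.F k ω = 1 := by
  have : (k + 1).toNat = 0 := by omega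
  simp [F, this, Fhist]

theorem Fhist_of_lt (ω : Ω) (k : ℕ) {j : ℤ} (hj : j < k) : M.Fhist ω k j = M.F j ω := by
  induction k with
  | zero =>
    have : (j + 1).toNat = 0 := by omega
    simp [F, this]
  | succ k ih =>
    by_cases h : j < k
    · rw [Fhist, Function.update_of_ne h.ne, ih h]
    · have : (j + 1).toNat = k + 1 := by omega
      rw [F, this]

theorem backC_congr (k : ℕ) (ω : Ω) {P Q : ℤ → Matrix (Fin N × Fin n) (Fin N × Fin n) ℝ}
    (h : ∀ j : ℤ, j < k → P j = Q j) (t : ℕ) (ht : t ≤ d) :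
    M.backC k ω P t = M.backC k ω Q t := by
  induction t with
  | zero => rfl
  | succ t ih => rw [backC, backC, ih (by omega), h _ (by omega)]

/-- First equation of the system. -/
theorem F_add_C_one (k : ℕ) (ω : Ω) : M.F k ω + M.C 1 k ω = M.sysMat k ω := by
  have e : ((k : ℤ) + 1).toNat = k + 1 := by omega
  have hF : M.F k ω = M.sysMat k ω - M.backC k ω (fun j => M.F j ω) d := by
    rw [F, e, Fhist, Function.update_self,
      M.backC_congr k ω (fun j hj => M.Fhist_of_lt ω k hj) d le_rfl]
  simp [hF, C]

theorem C_of_gt {q : ℕ} (hq : d < q) (k : ℕ) (ω : Ω) : M.C q k ω = 0 := by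
  have : d + 1 - q = 0 := by omega
  simp [C, this, backC]

/-- The other equations of the system, where `F(k-q)` is invertible (recall `C_{d+1}(k) = 0`). -/
theorem C_mul_F_sub (q : ℕ) (hq : 1 ≤ q) (hqd : q ≤ d) (k : ℕ) (ω : Ω)
    (hinv : IsUnit (M.F ((k : ℤ) - q) ω)) :
    M.C q k ω * M.F ((k : ℤ) - q) ω - M.C (q + 1) k ω = -(M.b k • M.Abar k q ω) := by
  have e1 : d + 1 - q = (d - q) + 1 := by omega
  have e2 : d - (d - q) = q := by omega
  have e3 : d + 1 - (q + 1) = d - q := by omega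
  have hq0 : q ≠ 0 := by omega
  have hdet := (Matrix.isUnit_iff_isUnit_det _).1 hinv
  simp only [C, hq0, if_false, Nat.succ_ne_zero, e1, e3, backC, e2]
  rw [Matrix.mul_assoc, Matrix.nonsing_inv_mul _ hdet, Matrix.mul_one]
  abel

/-! ### The delay-modified excitation quantity -/

/-- `Ā(k,q) ([Φ_F(k-1,k-q)]⁻¹ - I)`. -/
def delayTerm (k q : ℕ) (ω : Ω) : Matrix (Fin N × Fin n) (Fin N × Fin n) ℝ :=
  M.Abar k q ω * ((Phi (fun j => M.F j ω) ((k : ℤ) - 1) ((k : ℤ) - q))⁻¹ - 1)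

/-- The symmetric random matrix whose minimum eigenvalue is the excitation quantity. -/
def excMat (h m : ℕ) (ω : Ω) : Matrix (Fin N × Fin n) (Fin N × Fin n) ℝ :=
  ∑ k ∈ Finset.Ico (m * h) ((m + 1) * h),
    ((2 * (M.b k / M.a k)) •
        (condExpMat μ (M.sigmaF (((m * h : ℕ) : ℤ) - 1)) (M.symLap k) ω
          ⊗ₖ (1 : Matrix (Fin n) (Fin n) ℝ))
      + (2 : ℝ) • condExpMat μ (M.sigmaF (((m * h : ℕ) : ℤ) - 1))
          (fun ω' => (M.calH k ω')ᵀ * M.calH k ω') ω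
      - (M.b k / M.a k) • ∑ q ∈ Finset.range (d + 1),
          condExpMat μ (M.sigmaF (((m * h : ℕ) : ℤ) - 1)) (M.delayTerm k q) ω
      - (M.b k / M.a k) • ∑ q ∈ Finset.range (d + 1),
          condExpMat μ (M.sigmaF (((m * h : ℕ) : ℤ) - 1)) (fun ω' => (M.delayTerm k q ω')ᵀ) ω)

/-- The excitation quantity of the `m`-th time interval of length `h`. -/
def excitation (h m : ℕ) (ω : Ω) : ℝ := lambdaMin (M.excMat h m ω)

/-! ### Assumptions -/

/-- A1.a: the noise process is independent of the joint process of observation matrices, graphs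
and delays. -/
def A1a : Prop := Indep (⨆ s, M.sigmaNoise s) (⨆ s, M.sigmaEnv s) μ

/-- A1.b: the noise is a square integrable martingale difference sequence, with conditional second
moments bounded by `βv`. -/
def A1b (βv : ℝ) : Prop :=
  0 < βv ∧ (∀ k, MemLp (M.v k) 2 μ) ∧
  (∀ k : ℕ, μ[M.v k | M.sigmaF ((k : ℤ) - 1)] =ᵐ[μ] 0) ∧
  ∀ᵐ ω ∂μ, ∀ k : ℕ, (μ[fun ω' => ‖M.v k ω'‖ ^ 2 | M.sigmaF ((k : ℤ) - 1)]) ω ≤ βv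

open scoped Matrix.Norms.L2Operator in
/-- A2.b: almost sure uniform bounds on the weights and on the spectral norms of the observation
matrices. -/
def A2b (βa βH : ℝ) : Prop :=
  0 < βa ∧ 0 < βH ∧ (∀ᵐ ω ∂μ, ∀ k i j, |M.A k ω i j| ≤ βa) ∧
  ∀ᵐ ω ∂μ, ∀ i k, ‖M.H i k ω‖ ≤ βH

/-- A3.a: conditions on the gains. -/
def A3a : Prop :=
  (∀ k, 0 < M.a k) ∧ (∀ k, 0 < M.b k) ∧ Antitone M.a ∧ Antitone M.b ∧
  Tendsto M.a atTop (𝓝 0) ∧ Tendsto M.b atTop (𝓝 0) ∧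
  M.a =O[atTop] M.b ∧ (∀ m : ℕ, 0 < m → M.a =O[atTop] fun k => M.a (k + m)) ∧
  (fun k => M.b k ^ 2) =o[atTop] M.a ∧
  Tendsto (fun K => ∑ k ∈ Finset.range K, M.a k) atTop atTop

/-- A3.c: the consensus gain is small enough. -/
def A3c (βa βH Ca : ℝ) : Prop :=
  (∀ k, M.a k ≤ Ca * M.b k) ∧
  (⨆ k, M.b k) < sSup ((fun κ : ℝ =>
    min (κ / (2 * (N * βa + N * √N * βa + Ca * βH ^ 2)))
      (((1 - (1 - κ)⁻¹) * κ) / (2 * N * √N * βa * (1 - ((1 - κ) ^ (d + 1))⁻¹)))) ''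
    Set.Ioo (0 : ℝ) 1)

end Network

end DistEst

end

/-! Let `e(k)` be the stacked estimation error and call `e(k) - F(k-1) e(k-1)` the deviation
(`dev`). The equations for `F` and the `C_q` are made so that the delayed recursion telescopes: the
deviation at time `k+1` is a combination of the last `d` deviations with coefficients `C_q(k) =
O(b(k))`, plus the noise `a(k) 𝓗(k)ᵀ v(k)` (`IsEstimate.dev_succ`). As `b → 0`, the deviation is
`O(a)` in `L²`, so its delayed part is only `O(a b)`. Up to this small term and the noise, the error
obeys `e(k+1) = F(k) e(k)`, without delays. The small-gain condition makes all `F(k)` uniformly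
invertible, with `I - F(k) = O(b(k))`.

In the expansion of `E‖e(k+1)‖²` the noise is orthogonal to `F(k) e(k)`, since that vector depends
on the environment (graphs, observation matrices, delays) and on past noise only. With `y =
(E‖e(k)‖²)^{1/2}` the mean square thus changes by `-2 E⟨e, (I - F(k)) e⟩` and an error `O((b y +
a)²)` (`Regular.exists_one_step`). Over `h` steps all quadratic forms can be evaluated at the error
at the start of the block, at the same cost (`Regular.exists_multi_step`).

The link with the hypothesis is the identity that `(I - F(k)) + (I - F(k))ᵀ` is `a(k)` times the
summand of the excitation matrix before conditioning (`smul_excTerm`). The error at time `mh` is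
`ℱ(mh-1)`-measurable, so conditioning is free, and the eigenvalue bound `θ` gives a decrease of
about `θ a((m+1)h) E‖e(mh)‖²` per block. The forms have no sign, so replacing the weights `a(k)` by
`a((m+1)h)` costs a factor `η_m = O(b(mh) (1 - a((m+1)h)/a(mh)))`. These `η_m` are summable: as `b ≤
C √a`, each is at most a constant times `√a(mh) - √a((m+1)h)`, which telescopes.

Since `b² = o(a)`, the mean squares at block ends satisfy `Y' ≤ (1 - α_m + η_m) Y + o(α_m)`, where
`Σ α_m = ∞` and `Σ η_m < ∞`. Hence they tend to zero, and the increments inside a block are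
negligible. -/

namespace DistEst

/-! ### Real sequences -/

/-- A nonnegative sequence that contracts by `1 - α m` up to an error `o(α m)`, where `α` is not
summable, tends to zero. -/
theorem tendsto_zero_of_contraction {z α β : ℕ → ℝ} (hz : ∀ m, 0 ≤ z m)
    (hα1 : ∀ᶠ m in atTop, 0 ≤ α m ∧ α m ≤ 1)
    (hα : Tendsto (fun K => ∑ m ∈ Finset.range K, α m) atTop atTop)
    (hβ : ∀ ε > 0, ∀ᶠ m in atTop, β m ≤ ε * α m)
    (hrec : ∀ᶠ m in atTop, z (m + 1) ≤ (1 - α m) * z m + β m) :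
    Tendsto z atTop (𝓝 0) := by
  rw [Metric.tendsto_atTop]
  intro ε hε
  obtain ⟨m0, hm0⟩ := eventually_atTop.1 ((hα1.and (hβ (ε / 2) (by positivity))).and hrec)
  -- Once `β ≤ (ε / 2) α`, the excess `z - ε / 2` contracts by the pure factor `1 - α ≤ exp (-α)`.
  have key : ∀ l, z (m0 + l) - ε / 2 ≤
      Real.exp (-∑ j ∈ Finset.range l, α (m0 + j)) * z m0 := by
    have pre : ∀ l, z (m0 + l) - ε / 2 ≤ (∏ j ∈ Finset.range l, (1 - α (m0 + j))) * z m0 := by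
      intro l
      induction l with
      | zero => simp; linarith
      | succ l ih =>
        obtain ⟨⟨⟨h0, h1⟩, h2⟩, h3⟩ := hm0 (m0 + l) (by omega)
        rw [Finset.prod_range_succ, ← add_assoc]
        have := mul_le_mul_of_nonneg_left ih (sub_nonneg.2 h1)
        nlinarith
    intro l
    refine (pre l).trans (mul_le_mul_of_nonneg_right ?_ (hz m0))
    rw [← Finset.sum_neg_distrib, Real.exp_sum]
    refine Finset.prod_le_prod (fun j _ => ?_) fun j _ => ?_
    · linarith [(hm0 (m0 + j) (by omega)).1.1.2]
    · linarith [Real.add_one_le_exp (-α (m0 + j))]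
  have hs : Tendsto (fun l => ∑ j ∈ Finset.range l, α (m0 + j)) atTop atTop := by
    have h1 : Tendsto (fun l => (∑ m ∈ Finset.range (l + m0), α m) - ∑ m ∈ Finset.range m0, α m)
        atTop atTop :=
      tendsto_atTop_add_const_right _ _ (hα.comp (tendsto_add_atTop_nat m0))
    refine h1.congr fun l => ?_
    rw [add_comm l m0, Finset.sum_range_add]
    ring
  have hexp : Tendsto (fun l => Real.exp (-∑ j ∈ Finset.range l, α (m0 + j)) * z m0) atTop
      (𝓝 0) := by
    simpa using (Real.tendsto_exp_neg_atTop_nhds_zero.comp hs).mul_const (z m0)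
  obtain ⟨l0, hl0⟩ := eventually_atTop.1 (hexp.eventually (gt_mem_nhds (half_pos hε)))
  refine ⟨m0 + l0, fun m hm => ?_⟩
  obtain ⟨l, rfl⟩ := Nat.exists_eq_add_of_le (show m0 ≤ m by omega)
  have := hl0 l (by omega)
  have := key l
  rw [Real.dist_eq, sub_zero, abs_of_nonneg (hz _)]
  linarith

/-- As `tendsto_zero_of_contraction`, with a summable perturbation of the contraction factor. -/
theorem tendsto_zero_of_perturbed_contraction {y α η β : ℕ → ℝ} (hy : ∀ m, 0 ≤ y m)
    (hα1 : ∀ᶠ m in atTop, 0 ≤ α m ∧ α m ≤ 1 / 2) (hη0 : ∀ m, 0 ≤ η m) (hη : Summable η)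
    (hα : Tendsto (fun K => ∑ m ∈ Finset.range K, α m) atTop atTop)
    (hβ0 : ∀ m, 0 ≤ β m) (hβ : ∀ ε > 0, ∀ᶠ m in atTop, β m ≤ ε * α m)
    (hrec : ∀ᶠ m in atTop, y (m + 1) ≤ (1 - α m + η m) * y m + β m) :
    Tendsto y atTop (𝓝 0) := by
  -- For `α ≤ 1 / 2` one has `1 - α + η ≤ (1 - α) (1 + 2 η)`. Dividing by the product `P`, which
  -- stays between `1` and `exp (2 ∑ η)`, therefore removes the perturbation.
  set P : ℕ → ℝ := fun m => ∏ j ∈ Finset.range m, (1 + 2 * η j) with hP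
  have hP1 : ∀ m, 1 ≤ P m := fun m =>
    Finset.prod_induction _ (fun t => 1 ≤ t) (fun _ _ h1 h2 => one_le_mul_of_one_le_of_one_le h1 h2)
      le_rfl fun j _ => by linarith [hη0 j]
  have hPle : ∀ m, P m ≤ Real.exp (2 * ∑' j, η j) := by
    intro m
    calc P m ≤ ∏ j ∈ Finset.range m, Real.exp (2 * η j) :=
          Finset.prod_le_prod (fun j _ => by linarith [hη0 j]) fun j _ => by
            linarith [Real.add_one_le_exp (2 * η j)]
      _ = Real.exp (2 * ∑ j ∈ Finset.range m, η j) := by rw [← Real.exp_sum, Finset.mul_sum]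
      _ ≤ _ := Real.exp_le_exp.2 (mul_le_mul_of_nonneg_left
          (hη.sum_le_tsum _ fun j _ => hη0 j) two_pos.le)
  have hz : Tendsto (fun m => y m / P m) atTop (𝓝 0) := by
    refine tendsto_zero_of_contraction (fun m => div_nonneg (hy m) (by linarith [hP1 m]))
      (hα1.mono fun m hm => ⟨hm.1, by linarith [hm.2]⟩) hα hβ ?_
    filter_upwards [hα1, hrec] with m h1 h2
    have hp := hP1 m
    have hs : P (m + 1) = P m * (1 + 2 * η m) := by simp [hP, Finset.prod_range_succ]
    have h0 := hη0 m
    have h3 := hP1 (m + 1)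
    rw [div_le_iff₀ (by linarith)]
    have e1 : ((1 - α m) * (y m / P m) + β m) * P (m + 1)
        = (1 - α m) * y m * (1 + 2 * η m) + β m * P (m + 1) := by
      rw [hs]; field_simp
    rw [e1]
    have h4 : β m ≤ β m * P (m + 1) := le_mul_of_one_le_right (hβ0 m) h3
    have h5 : 0 ≤ y m * (η m * (1 - 2 * α m)) :=
      mul_nonneg (hy m) (mul_nonneg h0 (by linarith [h1.2]))
    nlinarith
  refine squeeze_zero hy (fun m => ?_) (by simpa using hz.const_mul (Real.exp (2 * ∑' j, η j)))
  have hp := hP1 m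
  calc y m = P m * (y m / P m) := by field_simp
    _ ≤ _ := mul_le_mul_of_nonneg_right (hPle m) (div_nonneg (hy m) (by linarith))

/-- A nonnegative sequence driven by its `d` last values, with gain `b k → 0`, and by a slowly
varying `a k` is `O(a k)`. -/
theorem exists_bound_of_delay_recursion {s a b : ℕ → ℝ} {d : ℕ} {K R : ℝ} (ha : ∀ k, 0 < a k)
    (hb0 : ∀ k, 0 ≤ b k) (hb : Tendsto b atTop (𝓝 0)) (hK : 0 ≤ K) (hR : 0 ≤ R)
    (haR : ∀ k q, q ≤ d → q ≤ k → a (k - q) ≤ R * a (k + 1))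
    (hrec : ∀ k, d ≤ k → s (k + 1) ≤ K * b k * ∑ q ∈ Finset.range d, s (k - q) + K * a k) :
    ∃ K', 0 ≤ K' ∧ ∀ k, s k ≤ K' * a k := by
  have hev : ∀ᶠ k in atTop, K * b k * (d * R) ≤ 1 / 2 := by
    have : Tendsto (fun k => K * b k * (d * R)) atTop (𝓝 0) := by
      simpa using (hb.const_mul K).mul_const (d * R)
    exact (this.eventually (gt_mem_nhds (by norm_num : (0 : ℝ) < 1 / 2))).mono fun _ h => h.le
  obtain ⟨k0, hk0⟩ := eventually_atTop.1 hev
  set k1 := max k0 d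
  -- The sum settles the times up to `k1`. Later on, past values contribute at most `K' a / 2`
  -- because the gain is small, and the driving term at most `K R a ≤ K' a / 2`.
  set K' := 2 * (K * R) + ∑ j ∈ Finset.range (k1 + 1), |s j| / a j with hK'
  have hnn : 0 ≤ ∑ j ∈ Finset.range (k1 + 1), |s j| / a j :=
    Finset.sum_nonneg fun j _ => div_nonneg (abs_nonneg _) (ha j).le
  have hK'0 : 0 ≤ K' := by positivity
  refine ⟨K', hK'0, fun k => ?_⟩
  induction k using Nat.strong_induction_on with
  | _ k ih =>
    by_cases hk : k ≤ k1
    · have h1 : |s k| / a k ≤ K' := by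
        have := Finset.single_le_sum (f := fun j => |s j| / a j)
          (fun j _ => div_nonneg (abs_nonneg _) (ha j).le)
          (Finset.mem_range.2 (Nat.lt_succ_of_le hk))
        have : 0 ≤ K * R := by positivity
        linarith
      rw [div_le_iff₀ (ha k)] at h1
      exact (le_abs_self _).trans h1
    · obtain ⟨k, rfl⟩ : ∃ j, k = j + 1 := ⟨k - 1, by omega⟩
      have hkd : d ≤ k := (le_max_right k0 d).trans (by omega)
      have hkk : k0 ≤ k := (le_max_left k0 d).trans (by omega)
      have h1 : ∑ q ∈ Finset.range d, s (k - q) ≤ d * (K' * (R * a (k + 1))) := by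
        calc ∑ q ∈ Finset.range d, s (k - q) ≤ ∑ _q ∈ Finset.range d, K' * (R * a (k + 1)) := by
              refine Finset.sum_le_sum fun q hq => (ih (k - q) (by omega)).trans ?_
              have := Finset.mem_range.1 hq
              exact mul_le_mul_of_nonneg_left (haR k q (by omega) (by omega)) hK'0
          _ = _ := by simp
      have h2 := hrec k hkd
      have h3 := mul_le_mul_of_nonneg_left h1 (mul_nonneg hK (hb0 k))
      have h4 : a k ≤ R * a (k + 1) := by simpa using haR k 0 (by omega) (by omega)
      have h5 := mul_le_mul_of_nonneg_left h4 hK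
      have h6 : K * b k * (d * (K' * (R * a (k + 1)))) ≤ 1 / 2 * (K' * a (k + 1)) := by
        have := mul_le_mul_of_nonneg_right (hk0 k hkk) (mul_nonneg hK'0 (ha (k + 1)).le)
        linarith
      have h7 : 2 * (K * R) * a (k + 1) ≤ K' * a (k + 1) :=
        mul_le_mul_of_nonneg_right (by linarith) (ha (k + 1)).le
      linarith

/-- If `b² ≤ C² a` and `a` is positive and decreasing, then the relative decrements of `a`, weighted
by `b`, are summable. -/
theorem summable_mul_one_sub_div {a b : ℕ → ℝ} (ha : ∀ k, 0 < a k) (hanti : Antitone a)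
    (hb0 : ∀ k, 0 ≤ b k) {C : ℝ} (hC : 0 ≤ C) (hba : ∀ k, b k ≤ C * √(a k)) :
    Summable fun k => b k * (1 - a (k + 1) / a k) := by
  have hle : ∀ k, a (k + 1) / a k ≤ 1 := fun k =>
    (div_le_one (ha k)).2 (hanti (Nat.le_succ k))
  refine summable_of_sum_range_le (c := 2 * C * √(a 0))
    (fun k => mul_nonneg (hb0 k) (by linarith [hle k])) fun K => ?_
  -- With `x = √(a k)` and `y = √(a (k + 1))`, the factor `x` from `b ≤ C x` turns `1 - y² / x²`
  -- into `(x - y) (x + y) / x ≤ 2 (x - y)`, and the square roots telescope.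
  have hterm : ∀ k, b k * (1 - a (k + 1) / a k) ≤ 2 * C * (√(a k) - √(a (k + 1))) := by
    intro k
    have hx := Real.sqrt_pos.2 (ha k)
    have hy := Real.sqrt_pos.2 (ha (k + 1))
    have hxy := Real.sqrt_le_sqrt (hanti (Nat.le_succ k))
    have e1 := Real.sq_sqrt (ha k).le
    have e2 := Real.sq_sqrt (ha (k + 1)).le
    set x := √(a k)
    set y := √(a (k + 1))
    have e3 : C * x * (1 - y ^ 2 / x ^ 2) = C * ((x - y) * ((x + y) / x)) := by
      field_simp
      ring
    rw [← e1, ← e2]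
    calc b k * (1 - y ^ 2 / x ^ 2) ≤ C * x * (1 - y ^ 2 / x ^ 2) := by
          refine mul_le_mul_of_nonneg_right (hba k) ?_
          rw [e1, e2]; linarith [hle k]
      _ = C * ((x - y) * ((x + y) / x)) := e3
      _ ≤ C * ((x - y) * 2) := by
          refine mul_le_mul_of_nonneg_left (mul_le_mul_of_nonneg_left ?_ (by linarith)) hC
          rw [div_le_iff₀ hx]; linarith
      _ = _ := by ring
  calc ∑ k ∈ Finset.range K, b k * (1 - a (k + 1) / a k)
      ≤ ∑ k ∈ Finset.range K, 2 * C * (√(a k) - √(a (k + 1))) :=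
        Finset.sum_le_sum fun k _ => hterm k
    _ = 2 * C * (√(a 0) - √(a K)) := by rw [← Finset.mul_sum, Finset.sum_range_sub']
    _ ≤ _ := mul_le_mul_of_nonneg_left (by linarith [Real.sqrt_nonneg (a K)]) (by positivity)

/-! ### The norm of square integrable random vectors -/

section L2
variable {Ω : Type*} [MeasurableSpace Ω] {μ : Measure Ω} {E : Type*} [NormedAddCommGroup E]

/-- Mean squares are treated throughout as squares of the real number `lpNorm`, so that the triangle
inequality of `L²` is at hand. -/
theorem sq_lpNorm_two {f : Ω → E} (hf : MemLp f 2 μ) :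
    lpNorm f 2 μ ^ 2 = ∫ ω, ‖f ω‖ ^ 2 ∂μ := by
  rw [lpNorm_eq_integral_norm_rpow_toReal (by simp) (by simp) hf.1]
  have h0 : 0 ≤ ∫ ω, ‖f ω‖ ^ 2 ∂μ := integral_nonneg fun _ => by positivity
  simp only [ENNReal.toReal_ofNat, Real.rpow_two]
  rw [← one_div, ← Real.sqrt_eq_rpow, Real.sq_sqrt h0]

theorem lpNorm_le_mul_of_ae {E' : Type*} [NormedAddCommGroup E'] {f : Ω → E} {g : Ω → E'} {c : ℝ}
    (hf : AEStronglyMeasurable f μ) (hg : MemLp g 2 μ) (hc : 0 ≤ c)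
    (h : ∀ᵐ ω ∂μ, ‖f ω‖ ≤ c * ‖g ω‖) : MemLp f 2 μ ∧ lpNorm f 2 μ ≤ c * lpNorm g 2 μ := by
  have hm : MemLp f 2 μ := hg.of_le_mul hf h
  refine ⟨hm, ?_⟩
  have h1 := eLpNorm_le_mul_eLpNorm_of_ae_le_mul h 2
  rw [← toReal_eLpNorm hf, ← toReal_eLpNorm hg.1]
  have h2 := ENNReal.toReal_mono (ENNReal.mul_ne_top ENNReal.ofReal_ne_top hg.2.ne) h1
  rwa [ENNReal.toReal_mul, ENNReal.toReal_ofReal hc] at h2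

theorem lpNorm_two_sum_le {ι : Type*} (s : Finset ι) {f : ι → Ω → E}
    (hf : ∀ i ∈ s, MemLp (f i) 2 μ) :
    lpNorm (fun ω => ∑ i ∈ s, f i ω) 2 μ ≤ ∑ i ∈ s, lpNorm (f i) 2 μ := by
  classical
  induction s using Finset.induction_on with
  | empty => simp
  | insert i s hi ih =>
    simp only [Finset.sum_insert hi]
    refine (lpNorm_add_le (g := fun ω => ∑ i ∈ s, f i ω)
      (hf i (Finset.mem_insert_self i s)) (by norm_num)).trans ?_
    gcongr
    exact ih fun j hj => hf j (Finset.mem_insert_of_mem hj)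

variable [InnerProductSpace ℝ E]

theorem integrable_inner_of_memLp {f g : Ω → E} (hf : MemLp f 2 μ) (hg : MemLp g 2 μ) :
    Integrable (fun ω => inner ℝ (f ω) (g ω)) μ :=
  (hf.norm.integrable_mul hg.norm).mono (hf.1.inner hg.1)
    (ae_of_all _ fun ω => by
      simpa using norm_inner_le_norm (𝕜 := ℝ) (f ω) (g ω))

theorem abs_integral_inner_le {f g : Ω → E} (hf : MemLp f 2 μ) (hg : MemLp g 2 μ) :
    |∫ ω, inner ℝ (f ω) (g ω) ∂μ| ≤ lpNorm f 2 μ * lpNorm g 2 μ := by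
  have e : ∫ ω, inner ℝ (f ω) (g ω) ∂μ = inner ℝ (hf.toLp f) (hg.toLp g) := by
    rw [L2.inner_def]
    refine integral_congr_ae ?_
    filter_upwards [hf.coeFn_toLp, hg.coeFn_toLp] with ω h1 h2
    rw [h1, h2]
  rw [e]
  refine (abs_real_inner_le_norm _ _).trans (le_of_eq ?_)
  rw [Lp.norm_toLp, Lp.norm_toLp, toReal_eLpNorm hf.1, toReal_eLpNorm hg.1]

theorem sq_lpNorm_two_add {f g : Ω → E} (hf : MemLp f 2 μ) (hg : MemLp g 2 μ) :
    lpNorm (fun ω => f ω + g ω) 2 μ ^ 2 =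
      lpNorm f 2 μ ^ 2 + 2 * ∫ ω, inner ℝ (f ω) (g ω) ∂μ + lpNorm g 2 μ ^ 2 := by
  have hfg : MemLp (fun ω => f ω + g ω) 2 μ := hf.add hg
  have hi : Integrable (fun ω => ‖f ω‖ ^ 2 + 2 * inner ℝ (f ω) (g ω)) μ :=
    hf.norm.integrable_sq.add ((integrable_inner_of_memLp hf hg).const_mul 2)
  rw [sq_lpNorm_two hfg, sq_lpNorm_two hf, sq_lpNorm_two hg, ← integral_const_mul,
    ← integral_add hf.norm.integrable_sq ((integrable_inner_of_memLp hf hg).const_mul 2),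
    ← integral_add hi hg.norm.integrable_sq]
  exact integral_congr_ae (ae_of_all _ fun ω => norm_add_sq_real _ _)

end L2

end DistEst

namespace DistEst

/-! ### Matrices acting on Euclidean vectors -/

section MatrixAction
open scoped Matrix.Norms.L2Operator
set_option linter.unusedSectionVars false
variable {ι κ ν : Type*} [Fintype ι] [Fintype κ] [Fintype ν]

/-- Action of a matrix on a Euclidean vector. -/
noncomputable def ap (A : Matrix ι κ ℝ) (x : EuclideanSpace ℝ κ) : EuclideanSpace ℝ ι :=
  WithLp.toLp 2 (A *ᵥ x.ofLp)

theorem ap_apply (A : Matrix ι κ ℝ) (x : EuclideanSpace ℝ κ) (i : ι) :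
    ap A x i = ∑ j, A i j * x j := rfl

theorem ap_sub (A : Matrix ι κ ℝ) (x y : EuclideanSpace ℝ κ) : ap A (x - y) = ap A x - ap A y := by
  simp [ap, Matrix.mulVec_sub]

theorem add_ap (A B : Matrix ι κ ℝ) (x : EuclideanSpace ℝ κ) : ap (A + B) x = ap A x + ap B x := by
  simp [ap, Matrix.add_mulVec]

theorem sub_ap (A B : Matrix ι κ ℝ) (x : EuclideanSpace ℝ κ) : ap (A - B) x = ap A x - ap B x := by
  simp [ap, Matrix.sub_mulVec]

theorem neg_ap (A : Matrix ι κ ℝ) (x : EuclideanSpace ℝ κ) : ap (-A) x = -ap A x := by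
  simp [ap, Matrix.neg_mulVec]

theorem smul_ap (c : ℝ) (A : Matrix ι κ ℝ) (x : EuclideanSpace ℝ κ) :
    ap (c • A) x = c • ap A x := by
  simp [ap, Matrix.smul_mulVec]

theorem zero_ap (x : EuclideanSpace ℝ κ) : ap (0 : Matrix ι κ ℝ) x = 0 := by
  simp [ap]

theorem one_ap [DecidableEq κ] (x : EuclideanSpace ℝ κ) : ap (1 : Matrix κ κ ℝ) x = x := by
  simp [ap]

theorem mul_ap (A : Matrix ι κ ℝ) (B : Matrix κ ν ℝ) (x : EuclideanSpace ℝ ν) :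
    ap (A * B) x = ap A (ap B x) := by
  simp [ap, Matrix.mulVec_mulVec]

theorem inner_ap_left (A : Matrix ι κ ℝ) (x : EuclideanSpace ℝ κ) (y : EuclideanSpace ℝ ι) :
    inner ℝ (ap A x) y = inner ℝ x (ap Aᵀ y) := by
  simp [ap, EuclideanSpace.inner_eq_star_dotProduct, Matrix.dotProduct_mulVec,
    Matrix.vecMul_transpose, dotProduct_comm]

variable [DecidableEq κ]

theorem norm_ap_le (A : Matrix ι κ ℝ) (x : EuclideanSpace ℝ κ) : ‖ap A x‖ ≤ ‖A‖ * ‖x‖ :=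
  Matrix.l2_opNorm_mulVec A x

theorem l2_opNorm_le_of_norm_ap_le {A : Matrix ι κ ℝ} {c : ℝ} (hc : 0 ≤ c)
    (h : ∀ x, ‖ap A x‖ ≤ c * ‖x‖) : ‖A‖ ≤ c := by
  rw [Matrix.l2_opNorm_def]
  exact ContinuousLinearMap.opNorm_le_bound _ hc h

theorem l2_opNorm_transpose [DecidableEq ι] (A : Matrix ι κ ℝ) : ‖Aᵀ‖ = ‖A‖ := by
  rw [← Matrix.conjTranspose_eq_transpose_of_trivial, Matrix.l2_opNorm_conjTranspose]

theorem abs_entry_le_l2_opNorm (A : Matrix ι κ ℝ) (i : ι) (j : κ) : |A i j| ≤ ‖A‖ := by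
  have h := norm_ap_le A (EuclideanSpace.single j 1)
  have h2 := PiLp.norm_apply_le (ap A (EuclideanSpace.single j 1)) i
  simp [ap] at h h2
  exact h2.trans h

theorem l2_opNorm_one_le : ‖(1 : Matrix κ κ ℝ)‖ ≤ 1 :=
  l2_opNorm_le_of_norm_ap_le zero_le_one fun x => by rw [one_ap, one_mul]

theorem isUnit_of_norm_sub_one_lt {A : Matrix κ κ ℝ} (h : ‖A - 1‖ < 1) : IsUnit A := by
  have := isUnit_one_sub_of_norm_lt_one (x := 1 - A) (by rwa [norm_sub_rev])
  simpa using this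

/-- As `A⁻¹ = 1 - (A - 1) A⁻¹`, the norm `t` of the inverse satisfies `t ≤ 1 + c t`. -/
theorem norm_inv_le {A : Matrix κ κ ℝ} {c : ℝ} (hc : c < 1) (h : ‖A - 1‖ ≤ c) :
    ‖A⁻¹‖ ≤ (1 - c)⁻¹ := by
  have hdet := (Matrix.isUnit_iff_isUnit_det _).1 (isUnit_of_norm_sub_one_lt (h.trans_lt hc))
  have e : A⁻¹ = 1 - (A - 1) * A⁻¹ := by
    rw [sub_mul, Matrix.mul_nonsing_inv _ hdet]; simp
  have h1 : ‖A⁻¹‖ ≤ 1 + c * ‖A⁻¹‖ := by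
    calc ‖A⁻¹‖ = ‖1 - (A - 1) * A⁻¹‖ := by rw [← e]
      _ ≤ ‖(1 : Matrix κ κ ℝ)‖ + ‖(A - 1) * A⁻¹‖ := norm_sub_le _ _
      _ ≤ 1 + c * ‖A⁻¹‖ := by
        gcongr
        · exact l2_opNorm_one_le
        · exact (norm_mul_le _ _).trans (by gcongr)
  rw [← one_div (1 - c), le_div_iff₀ (by linarith)]
  linarith

theorem kronecker_one_ap {N n : ℕ} (B : Matrix (Fin N) (Fin N) ℝ)
    (x : EuclideanSpace ℝ (Fin N × Fin n)) (i : Fin N) (c : Fin n) :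
    ap (B ⊗ₖ (1 : Matrix (Fin n) (Fin n) ℝ)) x (i, c) = ∑ j, B i j * x (j, c) := by
  simp [ap_apply, Fintype.sum_prod_type, Matrix.one_apply]

/-- The Kronecker product acts as `B` on each of the `n` coordinates separately; Cauchy–Schwarz on
the rows of `B` does the rest. -/
theorem l2_opNorm_kronecker_one_le {N n : ℕ} (B : Matrix (Fin N) (Fin N) ℝ) {β : ℝ} (hβ : 0 ≤ β)
    (h : ∀ i j, |B i j| ≤ β) : ‖B ⊗ₖ (1 : Matrix (Fin n) (Fin n) ℝ)‖ ≤ N * β := by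
  refine l2_opNorm_le_of_norm_ap_le (by positivity) fun x => ?_
  refine abs_le_of_sq_le_sq' ?_ (by positivity) |>.2
  rw [mul_pow, EuclideanSpace.norm_sq_eq, EuclideanSpace.norm_sq_eq, Fintype.sum_prod_type,
    Fintype.sum_prod_type, Finset.sum_comm (s := Finset.univ (α := Fin N))]
  simp only [Real.norm_eq_abs, sq_abs, kronecker_one_ap]
  have hrow : ∀ (i : Fin N) (c : Fin n),
      (∑ j, B i j * x (j, c)) ^ 2 ≤ N * β ^ 2 * ∑ j, x (j, c) ^ 2 := by
    intro i c
    refine (Finset.sum_mul_sq_le_sq_mul_sq _ _ _).trans ?_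
    refine mul_le_mul_of_nonneg_right ?_ (Finset.sum_nonneg fun _ _ => sq_nonneg _)
    calc ∑ j, B i j ^ 2 ≤ ∑ _j : Fin N, β ^ 2 :=
          Finset.sum_le_sum fun j _ => sq_le_sq' (abs_le.1 (h i j)).1 (abs_le.1 (h i j)).2
      _ = N * β ^ 2 := by simp
  calc ∑ c, ∑ i, (∑ j, B i j * x (j, c)) ^ 2
      ≤ ∑ c, ∑ _i : Fin N, N * β ^ 2 * ∑ j, x (j, c) ^ 2 :=
        Finset.sum_le_sum fun c _ => Finset.sum_le_sum fun i _ => hrow i c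
    _ = (N * β) ^ 2 * ∑ c, ∑ j, x (j, c) ^ 2 := by
        simp only [Finset.sum_const, Finset.card_univ, Fintype.card_fin, nsmul_eq_mul,
          ← Finset.mul_sum]
        ring
    _ = _ := by rw [Finset.sum_comm, mul_pow]

end MatrixAction

theorem prodFrom_succ' {ι : Type*} [Fintype ι] [DecidableEq ι] (Z : ℤ → Matrix ι ι ℝ) (i : ℤ)
    (l : ℕ) : prodFrom Z i (l + 1) = prodFrom Z (i + 1) l * Z i := by
  induction l with
  | zero => simp [prodFrom]
  | succ l ih =>
    rw [prodFrom, ih, prodFrom, ← Matrix.mul_assoc]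
    congr 3
    push_cast
    ring

theorem Phi_sub_succ {ι : Type*} [Fintype ι] [DecidableEq ι] (Z : ℤ → Matrix ι ι ℝ) (k : ℤ)
    (q : ℕ) : Phi Z (k - 1) (k - ((q + 1 : ℕ) : ℤ)) =
      Phi Z (k - 1) (k - (q : ℤ)) * Z (k - ((q + 1 : ℕ) : ℤ)) := by
  have e1 : (k - 1 + 1 - (k - ((q + 1 : ℕ) : ℤ))).toNat = q + 1 := by omega
  have e2 : (k - 1 + 1 - (k - (q : ℤ))).toNat = q := by omega
  rw [Phi, Phi, e1, e2, prodFrom_succ']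
  congr 2
  push_cast
  ring

namespace Network

variable {Ω : Type*} [MeasurableSpace Ω] {μ : Measure Ω} {N n d : ℕ} (M : Network Ω μ N n d)

/-! ### Bounds of the equivalent system -/

section Bounds
open scoped Matrix.Norms.L2Operator

/-- The bounds on weights and observation matrices hold at `ω`. -/
def BoundedAt (βa βH : ℝ) (ω : Ω) : Prop :=
  (∀ k i j, |M.A k ω i j| ≤ βa) ∧ ∀ i k, ‖M.H i k ω‖ ≤ βH

theorem calH_ap (k : ℕ) (ω : Ω) (y : EuclideanSpace ℝ (Fin N × Fin n)) (i : Fin N)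
    (r : Fin (M.p i)) : ap (M.calH k ω) y ⟨i, r⟩ = ∑ c, M.H i k ω r c * y (i, c) := by
  simp only [ap_apply, calH, Matrix.of_apply, Fintype.sum_prod_type, ite_mul, zero_mul]
  rw [Finset.sum_comm]
  simp

theorem calH_transpose_ap (k : ℕ) (ω : Ω) (w : EuclideanSpace ℝ (Σ i : Fin N, Fin (M.p i)))
    (i : Fin N) (c : Fin n) :
    ap (M.calH k ω)ᵀ w (i, c) = ∑ r, M.H i k ω r c * w ⟨i, r⟩ := by
  simp only [ap_apply, calH, Matrix.transpose_apply, Matrix.of_apply, ite_mul, zero_mul]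
  rw [Fintype.sum_sigma, Finset.sum_eq_single i]
  · simp
  · intro j _ hj
    simp [hj]
  · simp

variable {M} {βa βH κ : ℝ} {ω : Ω}

/-- Block diagonality: the squared norms of the blocks add up over the nodes, so the number of nodes
does not enter the bound. -/
theorem BoundedAt.norm_calH_le (h : M.BoundedAt βa βH ω) (hβH : 0 ≤ βH) (k : ℕ) :
    ‖M.calH k ω‖ ≤ βH := by
  refine l2_opNorm_le_of_norm_ap_le hβH fun x => ?_
  refine abs_le_of_sq_le_sq' ?_ (by positivity) |>.2
  rw [mul_pow, EuclideanSpace.norm_sq_eq, EuclideanSpace.norm_sq_eq, Fintype.sum_sigma,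
    Fintype.sum_prod_type, Finset.mul_sum]
  refine Finset.sum_le_sum fun i _ => ?_
  have h1 := norm_ap_le (M.H i k ω) (WithLp.toLp 2 fun c => x (i, c))
  have h2 := h1.trans (mul_le_mul_of_nonneg_right (h.2 i k) (norm_nonneg _))
  have h3 := pow_le_pow_left₀ (norm_nonneg _) h2 2
  rw [mul_pow, EuclideanSpace.norm_sq_eq, EuclideanSpace.norm_sq_eq] at h3
  simp only [calH_ap]
  simpa [ap_apply] using h3

theorem BoundedAt.norm_Abar_le (h : M.BoundedAt βa βH ω) (hβa : 0 ≤ βa) (k q : ℕ) :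
    ‖M.Abar k q ω‖ ≤ N * βa := by
  refine l2_opNorm_kronecker_one_le _ hβa fun i j => ?_
  simp only [Matrix.hadamard_apply, delayMat, Matrix.of_apply]
  split_ifs
  · simpa using h.1 k i j
  · simpa using hβa

theorem BoundedAt.norm_degMat_le (h : M.BoundedAt βa βH ω) (hβa : 0 ≤ βa) (k : ℕ) :
    ‖M.degMat k ω ⊗ₖ (1 : Matrix (Fin n) (Fin n) ℝ)‖ ≤ N * βa := by
  rw [degMat, ← Matrix.diagonal_one, Matrix.diagonal_kronecker_diagonal,
    Matrix.l2_opNorm_diagonal]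
  refine (pi_norm_le_iff_of_nonneg (by positivity)).2 fun ic => ?_
  rw [mul_one, Real.norm_eq_abs]
  refine (Finset.abs_sum_le_sum_abs _ _).trans ?_
  calc ∑ j, |M.A k ω ic.1 j| ≤ ∑ _j : Fin N, βa := Finset.sum_le_sum fun j _ => h.1 k _ j
    _ = N * βa := by simp

variable (M) in
/-- The gains are so small that `‖F(k) - I‖ ≤ κ`. -/
structure SmallGain (βa βH κ : ℝ) : Prop where
  pos : 0 < κ
  lt_one : κ < 1
  βa_nonneg : 0 ≤ βa
  βH_nonneg : 0 ≤ βH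
  a_nonneg : ∀ k, 0 ≤ M.a k
  b_nonneg : ∀ k, 0 ≤ M.b k
  direct : ∀ k, M.b k * (N * βa) + M.b k * (N * βa) + M.a k * βH ^ 2 ≤ κ / 2
  delayed : ∀ k, M.b k * (N * βa) * ∑ s ∈ Finset.range d, ((1 - κ)⁻¹) ^ (s + 1) ≤ κ / 2

theorem SmallGain.inv_nonneg (hs : M.SmallGain βa βH κ) : 0 ≤ (1 - κ)⁻¹ :=
  _root_.inv_nonneg.2 (by linarith [hs.lt_one])

theorem BoundedAt.norm_one_sub_sysMat_le (h : M.BoundedAt βa βH ω)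
    (hs : M.SmallGain βa βH κ) (k : ℕ) :
    ‖1 - M.sysMat k ω‖ ≤ M.b k * (N * βa) + M.b k * (N * βa) + M.a k * βH ^ 2 := by
  have e : 1 - M.sysMat k ω = M.b k • (M.degMat k ω ⊗ₖ (1 : Matrix (Fin n) (Fin n) ℝ))
      - M.b k • M.Abar k 0 ω + M.a k • ((M.calH k ω)ᵀ * M.calH k ω) := by
    rw [sysMat]; abel
  have hH : ‖(M.calH k ω)ᵀ * M.calH k ω‖ ≤ βH ^ 2 := by
    refine (Matrix.l2_opNorm_mul _ _).trans ?_
    rw [l2_opNorm_transpose, sq]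
    have := h.norm_calH_le hs.βH_nonneg k
    have := hs.βH_nonneg
    gcongr
  have hD := h.norm_degMat_le hs.βa_nonneg k
  have hA := h.norm_Abar_le hs.βa_nonneg k 0
  have ha := hs.a_nonneg k
  have hb := hs.b_nonneg k
  rw [e]
  refine (norm_add_le _ _).trans ?_
  refine add_le_add ((norm_sub_le _ _).trans ?_) ?_
  · rw [norm_smul, norm_smul, Real.norm_of_nonneg hb]
    gcongr
  · rw [norm_smul, Real.norm_of_nonneg ha]
    gcongr

/-- With `ρ = (1 - κ)⁻¹`, each substitution step gives `u_{t+1} ≤ (u_t + b N βa) ρ` for the norms, a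
recursion that the geometric sum solves. -/
theorem BoundedAt.norm_backC_le (h : M.BoundedAt βa βH ω) (hs : M.SmallGain βa βH κ) (k : ℕ)
    {P : ℤ → Matrix (Fin N × Fin n) (Fin N × Fin n) ℝ}
    (hP : ∀ j < (k : ℤ), ‖(P j)⁻¹‖ ≤ (1 - κ)⁻¹) (t : ℕ) (ht : t ≤ d) :
    ‖M.backC k ω P t‖ ≤
      M.b k * (N * βa) * ∑ s ∈ Finset.range t, ((1 - κ)⁻¹) ^ (s + 1) := by
  have hρ := hs.inv_nonneg
  have hb := hs.b_nonneg k
  have hβ := hs.βa_nonneg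
  induction t with
  | zero => simp [backC]
  | succ t ih =>
    have ih := ih (by omega)
    have e : M.b k * (N * βa) * ∑ s ∈ Finset.range (t + 1), ((1 - κ)⁻¹) ^ (s + 1)
        = (M.b k * (N * βa) * ∑ s ∈ Finset.range t, ((1 - κ)⁻¹) ^ (s + 1) + M.b k * (N * βa))
          * (1 - κ)⁻¹ := by
      rw [Finset.sum_range_succ']
      simp only [pow_succ, ← Finset.sum_mul]
      ring
    rw [backC, e]
    refine (norm_mul_le _ _).trans ?_
    refine mul_le_mul ?_ (hP _ (by omega)) (norm_nonneg _) (by positivity)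
    refine (norm_sub_le _ _).trans (add_le_add ih ?_)
    rw [norm_smul, Real.norm_of_nonneg hb]
    have := h.norm_Abar_le hβ k (d - t)
    gcongr

theorem C_one_eq (k : ℕ) : M.C 1 k ω = M.backC k ω (fun j => M.F j ω) d := by simp [C]

/-- A bootstrap over time: the bound at earlier times controls the inverses in the back
substitution, hence `C_1(k)`. The undelayed terms and `C_1(k)` use up `κ / 2` each. -/
theorem BoundedAt.norm_F_sub_one_le (h : M.BoundedAt βa βH ω) (hs : M.SmallGain βa βH κ) (k : ℤ) :
    ‖M.F k ω - 1‖ ≤ κ := by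
  rcases lt_or_ge k 0 with hk | hk
  · rw [M.F_of_neg hk, sub_self, norm_zero]; exact hs.pos.le
  lift k to ℕ using hk
  induction k using Nat.strong_induction_on with
  | _ k ih =>
    have hP : ∀ j < (k : ℤ), ‖(M.F j ω)⁻¹‖ ≤ (1 - κ)⁻¹ := by
      intro j hj
      refine norm_inv_le hs.lt_one ?_
      rcases lt_or_ge j 0 with hj0 | hj0
      · rw [M.F_of_neg hj0, sub_self, norm_zero]; exact hs.pos.le
      · lift j to ℕ using hj0
        exact ih j (by omega)
    have e : M.F k ω - 1 = -((1 - M.sysMat k ω) + M.backC k ω (fun j => M.F j ω) d) := by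
      rw [← M.F_add_C_one, C_one_eq]; abel
    rw [e, norm_neg]
    refine (norm_add_le _ _).trans ?_
    have h1 := (h.norm_one_sub_sysMat_le hs k).trans (hs.direct k)
    have h2 := (h.norm_backC_le hs k hP d le_rfl).trans (hs.delayed k)
    linarith

theorem BoundedAt.isUnit_F (h : M.BoundedAt βa βH ω) (hs : M.SmallGain βa βH κ) (k : ℤ) :
    IsUnit (M.F k ω) :=
  isUnit_of_norm_sub_one_lt ((h.norm_F_sub_one_le hs k).trans_lt hs.lt_one)

theorem BoundedAt.norm_inv_F_le (h : M.BoundedAt βa βH ω) (hs : M.SmallGain βa βH κ) (k : ℤ) :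
    ‖(M.F k ω)⁻¹‖ ≤ (1 - κ)⁻¹ := norm_inv_le hs.lt_one (h.norm_F_sub_one_le hs k)

theorem BoundedAt.norm_C_le (h : M.BoundedAt βa βH ω) (hs : M.SmallGain βa βH κ) (q k : ℕ) :
    ‖M.C q k ω‖ ≤ (N * βa * ∑ s ∈ Finset.range d, ((1 - κ)⁻¹) ^ (s + 1)) * M.b k := by
  have hρ := hs.inv_nonneg
  have hb := hs.b_nonneg k
  have hβ := hs.βa_nonneg
  have h0 : 0 ≤ (N * βa * ∑ s ∈ Finset.range d, ((1 - κ)⁻¹) ^ (s + 1)) * M.b k := by positivity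
  rw [C]
  split_ifs with hq
  · simpa using h0
  · refine (h.norm_backC_le hs k (fun j _ => h.norm_inv_F_le hs j) (d + 1 - q) (by omega)).trans ?_
    have hsum : ∑ s ∈ Finset.range (d + 1 - q), ((1 - κ)⁻¹) ^ (s + 1)
        ≤ ∑ s ∈ Finset.range d, ((1 - κ)⁻¹) ^ (s + 1) :=
      Finset.sum_le_sum_of_subset_of_nonneg (Finset.range_mono (by omega))
        fun _ _ _ => by positivity
    have := mul_le_mul_of_nonneg_left hsum (show 0 ≤ M.b k * (N * βa) by positivity)
    linarith

/-- Sharpens the fixed bound `κ` to one that decays like `b(k)`; `a ≤ Ca b` converts the innovation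
term. -/
theorem BoundedAt.norm_one_sub_F_le (h : M.BoundedAt βa βH ω) (hs : M.SmallGain βa βH κ) {Ca : ℝ}
    (hCa : ∀ k, M.a k ≤ Ca * M.b k) (k : ℕ) :
    ‖1 - M.F k ω‖ ≤ (N * βa + N * βa + Ca * βH ^ 2 +
      N * βa * ∑ s ∈ Finset.range d, ((1 - κ)⁻¹) ^ (s + 1)) * M.b k := by
  have e : 1 - M.F k ω = (1 - M.sysMat k ω) + M.C 1 k ω := by
    rw [← M.F_add_C_one]; abel
  rw [e]
  refine (norm_add_le _ _).trans ?_
  have h1 := h.norm_one_sub_sysMat_le hs k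
  have h2 := h.norm_C_le hs 1 k
  have h3 := mul_le_mul_of_nonneg_right (hCa k) (sq_nonneg βH)
  linarith

end Bounds

end Network
end DistEst

namespace DistEst
namespace Network

variable {Ω : Type*} [MeasurableSpace Ω] {μ : Measure Ω} {N n d : ℕ} (M : Network Ω μ N n d)

/-! ### Unrolled back substitution and the excitation identity -/

section Identities

/-- Each link has exactly one delay, so the masks split the adjacency matrix. -/
theorem sum_Abar (k : ℕ) (ω : Ω) :
    ∑ q ∈ Finset.range (d + 1), M.Abar k q ω = M.A k ω ⊗ₖ (1 : Matrix (Fin n) (Fin n) ℝ) := by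
  ext ⟨i, c⟩ ⟨j, c'⟩
  rw [Matrix.sum_apply]
  simp only [Abar, Matrix.kroneckerMap_apply, Matrix.hadamard_apply, delayMat, Matrix.of_apply]
  rw [Finset.sum_eq_single (M.delay k j i ω : ℕ)]
  · simp
  · intro q _ hq
    simp [hq.symm]
  · intro h
    exact absurd (Finset.mem_range.2 (M.delay k j i ω).2) h

/-- The first `r` delay equations are solved for `C_1(k)`, with `C_{r+1}(k)` as remainder. Inverses
are only composed and never cancelled, so this holds at every `ω`, even for singular `F`. -/
theorem backC_eq_sum_add (k : ℕ) (ω : Ω) (r : ℕ) (hr : r ≤ d) :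
    M.backC k ω (fun j => M.F j ω) d =
      -(M.b k • ∑ q ∈ Finset.range r, M.Abar k (q + 1) ω *
        (Phi (fun j => M.F j ω) ((k : ℤ) - 1) ((k : ℤ) - ((q + 1 : ℕ) : ℤ)))⁻¹)
      + M.backC k ω (fun j => M.F j ω) (d - r) *
        (Phi (fun j => M.F j ω) ((k : ℤ) - 1) ((k : ℤ) - (r : ℤ)))⁻¹ := by
  induction r with
  | zero => simp [Phi, prodFrom]
  | succ r ih =>
    obtain ⟨t, rfl⟩ : ∃ t, d = r + 1 + t := ⟨d - (r + 1), by omega⟩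
    have e1 : r + 1 + t - r = t + 1 := by omega
    have e2 : r + 1 + t - (r + 1) = t := by omega
    have e3 : r + 1 + t - t = r + 1 := by omega
    rw [ih (by omega), e1, e2, Finset.sum_range_succ, Phi_sub_succ _ _ r, Matrix.mul_inv_rev]
    conv_lhs => rw [backC, e3]
    rw [sub_mul, sub_mul, smul_add, Matrix.smul_mul, Matrix.smul_mul]
    simp only [Matrix.mul_assoc]
    abel

theorem C_one_eq_sum (k : ℕ) (ω : Ω) :
    M.C 1 k ω = -(M.b k • ∑ q ∈ Finset.range d, M.Abar k (q + 1) ω *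
        (Phi (fun j => M.F j ω) ((k : ℤ) - 1) ((k : ℤ) - ((q + 1 : ℕ) : ℤ)))⁻¹) := by
  rw [C_one_eq, M.backC_eq_sum_add k ω d le_rfl]
  simp [backC]

/-- Adding and subtracting `Ā(k,q)` in the unrolled `C_1(k)` makes the degree matrix into the
Laplacian, and leaves the factors `Φ⁻¹ - I`. The term `q = 0` vanishes since `Φ_F(k-1,k)` is empty.
-/
theorem one_sub_F_eq (k : ℕ) (ω : Ω) :
    1 - M.F k ω = M.b k • (M.lap k ω ⊗ₖ (1 : Matrix (Fin n) (Fin n) ℝ))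
      + M.a k • ((M.calH k ω)ᵀ * M.calH k ω)
      - M.b k • ∑ q ∈ Finset.range (d + 1), M.delayTerm k q ω := by
  have e : 1 - M.F k ω = 1 - M.sysMat k ω + M.C 1 k ω := by
    rw [← M.F_add_C_one]; abel
  have e2 : ∑ q ∈ Finset.range (d + 1), M.delayTerm k q ω =
      (∑ q ∈ Finset.range d, M.Abar k (q + 1) ω *
        (Phi (fun j => M.F j ω) ((k : ℤ) - 1) ((k : ℤ) - ((q + 1 : ℕ) : ℤ)))⁻¹) + M.Abar k 0 ω
      - M.A k ω ⊗ₖ (1 : Matrix (Fin n) (Fin n) ℝ) := by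
    simp only [delayTerm, mul_sub, mul_one, Finset.sum_sub_distrib, M.sum_Abar]
    rw [Finset.sum_range_succ']
    simp [Phi, prodFrom]
  have e3 : M.lap k ω ⊗ₖ (1 : Matrix (Fin n) (Fin n) ℝ) =
      M.degMat k ω ⊗ₖ (1 : Matrix (Fin n) (Fin n) ℝ)
        - M.A k ω ⊗ₖ (1 : Matrix (Fin n) (Fin n) ℝ) := by
    ext ⟨i, c⟩ ⟨j, c'⟩
    simp [lap, sub_mul]
  rw [e, e2, e3, M.C_one_eq_sum, sysMat]
  simp only [smul_sub, smul_add]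
  abel

/-- The random matrix whose conditional expectations add up to `excMat`. -/
noncomputable def excTerm (k : ℕ) (ω : Ω) : Matrix (Fin N × Fin n) (Fin N × Fin n) ℝ :=
  (2 * (M.b k / M.a k)) • (M.symLap k ω ⊗ₖ (1 : Matrix (Fin n) (Fin n) ℝ))
    + (2 : ℝ) • ((M.calH k ω)ᵀ * M.calH k ω)
    - (M.b k / M.a k) • ∑ q ∈ Finset.range (d + 1), M.delayTerm k q ω
    - (M.b k / M.a k) • ∑ q ∈ Finset.range (d + 1), (M.delayTerm k q ω)ᵀ

/-- The bridge between hypothesis and dynamics: the excitation matrix is built from the symmetric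
part of the decrement `I - F(k)`, rescaled by `a(k)`. -/
theorem smul_excTerm (k : ℕ) (ω : Ω) (ha : M.a k ≠ 0) :
    M.a k • M.excTerm k ω = (1 - M.F k ω) + (1 - M.F k ω)ᵀ := by
  have e1 : M.a k * (M.b k / M.a k) = M.b k := by field_simp
  have e3 : (2 * M.b k) • (M.symLap k ω ⊗ₖ (1 : Matrix (Fin n) (Fin n) ℝ)) =
      M.b k • (M.lap k ω ⊗ₖ (1 : Matrix (Fin n) (Fin n) ℝ))
      + M.b k • (M.lap k ω ⊗ₖ (1 : Matrix (Fin n) (Fin n) ℝ))ᵀ := by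
    ext ⟨i, c⟩ ⟨j, c'⟩
    have : (1 : Matrix (Fin n) (Fin n) ℝ) c' c = (1 : Matrix (Fin n) (Fin n) ℝ) c c' := by
      simp [Matrix.one_apply, eq_comm]
    simp only [symLap, Matrix.smul_apply, Matrix.add_apply, Matrix.kroneckerMap_apply,
      Matrix.transpose_apply, smul_eq_mul, this]
    ring
  have e2 : M.a k * (2 * (M.b k / M.a k)) = 2 * M.b k := by field_simp
  rw [M.one_sub_F_eq, excTerm]
  simp only [smul_sub, smul_add, smul_smul, e1, e2, e3, Matrix.transpose_sub,
    Matrix.transpose_add, Matrix.transpose_smul, Matrix.transpose_mul, Matrix.transpose_transpose,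
    Matrix.transpose_sum]
  rw [mul_comm, two_mul, add_smul]
  abel

end Identities

/-! ### Error dynamics and the telescoping of the delays -/

section ErrorRecursion

variable {M} {x : Fin N → ℤ → Ω → EuclideanSpace ℝ (Fin n)}

variable (M) in
/-- Stacked estimation error of all nodes. -/
def err (x : Fin N → ℤ → Ω → EuclideanSpace ℝ (Fin n)) (k : ℤ) (ω : Ω) :
    EuclideanSpace ℝ (Fin N × Fin n) :=
  WithLp.toLp 2 fun ic => x ic.1 k ω ic.2 - M.x₀ ic.2

theorem err_apply (k : ℤ) (ω : Ω) (i : Fin N) (c : Fin n) :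
    M.err x k ω (i, c) = x i k ω c - M.x₀ c := rfl

/-- The parameter `x₀` cancels in the consensus differences and in `z - H x = v - H (x - x₀)`. Nodes
outside the neighbourhood have weight zero and may be summed over too. -/
theorem IsEstimate.err_succ (hx : M.IsEstimate x) (k : ℕ) (ω : Ω) :
    M.err x ((k : ℤ) + 1) ω = ap (M.sysMat k ω) (M.err x k ω)
      + M.b k • ∑ q ∈ Finset.range d, ap (M.Abar k (q + 1) ω) (M.err x (k - ((q + 1 : ℕ) : ℤ)) ω)
      + M.a k • ap (M.calH k ω)ᵀ (M.v k ω) := by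
  have hsys : ap (M.sysMat k ω) (M.err x k ω)
      + M.b k • ∑ q ∈ Finset.range d, ap (M.Abar k (q + 1) ω) (M.err x (k - ((q + 1 : ℕ) : ℤ)) ω)
      = M.err x k ω - M.b k • ap (M.degMat k ω ⊗ₖ (1 : Matrix (Fin n) (Fin n) ℝ)) (M.err x k ω)
        - M.a k • ap (M.calH k ω)ᵀ (ap (M.calH k ω) (M.err x k ω))
        + M.b k • ∑ q ∈ Finset.range (d + 1), ap (M.Abar k q ω) (M.err x (k - (q : ℤ)) ω) := by
    rw [Finset.sum_range_succ' _ d, sysMat, add_ap, sub_ap, sub_ap, one_ap, smul_ap, smul_ap,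
      smul_ap, mul_ap, smul_add]
    simp only [Nat.cast_zero, sub_zero]
    abel
  rw [hsys]
  ext ⟨i, c⟩
  have hcons : (∑ j ∈ M.nbr i k ω,
      M.A k ω i j • (x j ((k : ℤ) - ((M.delay k j i ω : ℕ) : ℤ)) ω - x i k ω)) c =
      (∑ q ∈ Finset.range (d + 1), ap (M.Abar k q ω) (M.err x (k - (q : ℤ)) ω)) (i, c)
      - ap (M.degMat k ω ⊗ₖ (1 : Matrix (Fin n) (Fin n) ℝ)) (M.err x k ω) (i, c) := by
    have h1 : (∑ q ∈ Finset.range (d + 1), ap (M.Abar k q ω) (M.err x (k - (q : ℤ)) ω)) (i, c)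
        = ∑ j, M.A k ω i j * M.err x ((k : ℤ) - ((M.delay k j i ω : ℕ) : ℤ)) ω (j, c) := by
      simp only [WithLp.ofLp_sum, Finset.sum_apply, Abar, kronecker_one_ap, Matrix.hadamard_apply,
        delayMat, Matrix.of_apply]
      rw [Finset.sum_comm]
      refine Finset.sum_congr rfl fun j _ => ?_
      rw [Finset.sum_eq_single (M.delay k j i ω : ℕ)]
      · simp
      · intro q _ hq
        simp [hq.symm]
      · intro h
        exact absurd (Finset.mem_range.2 (M.delay k j i ω).2) h
    have h2 : ap (M.degMat k ω ⊗ₖ (1 : Matrix (Fin n) (Fin n) ℝ)) (M.err x k ω) (i, c)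
        = ∑ j, M.A k ω i j * M.err x k ω (i, c) := by
      rw [kronecker_one_ap, degMat, Finset.sum_eq_single i]
      · simp [Finset.sum_mul]
      · intro j _ hj
        simp [hj.symm]
      · simp
    have h3 : (∑ j ∈ M.nbr i k ω,
        M.A k ω i j • (x j ((k : ℤ) - ((M.delay k j i ω : ℕ) : ℤ)) ω - x i k ω)) c =
        ∑ j, M.A k ω i j * (x j ((k : ℤ) - ((M.delay k j i ω : ℕ) : ℤ)) ω c - x i k ω c) := by
      simp only [WithLp.ofLp_sum, Finset.sum_apply, PiLp.smul_apply, PiLp.sub_apply, smul_eq_mul]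
      rw [nbr, Finset.sum_filter]
      refine Finset.sum_congr rfl fun j _ => ?_
      by_cases h : M.A k ω i j = 0 <;> simp [h]
    rw [h1, h2, h3, ← Finset.sum_sub_distrib]
    refine Finset.sum_congr rfl fun j _ => ?_
    rw [err_apply, err_apply]
    ring
  have hinn : ((M.H i k ω)ᵀ *ᵥ (M.z i k ω - M.H i k ω *ᵥ (x i k ω).ofLp)) c =
      ap (M.calH k ω)ᵀ (M.v k ω) (i, c)
        - ap (M.calH k ω)ᵀ (ap (M.calH k ω) (M.err x k ω)) (i, c) := by
    rw [calH_transpose_ap, calH_transpose_ap, ← Finset.sum_sub_distrib]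
    simp only [Matrix.mulVec, dotProduct, Matrix.transpose_apply]
    refine Finset.sum_congr rfl fun r _ => ?_
    rw [calH_ap, ← mul_sub]
    congr 1
    simp only [z, vNode, Pi.sub_apply, Pi.add_apply, Matrix.mulVec, dotProduct, err_apply, mul_sub,
      Finset.sum_sub_distrib]
    ring
  have hstep := congrArg (fun y : EuclideanSpace ℝ (Fin n) => y c) (hx.step i k ω)
  simp only [PiLp.add_apply, PiLp.smul_apply] at hstep
  rw [hcons, hinn] at hstep
  simp only [PiLp.add_apply, PiLp.sub_apply, PiLp.smul_apply, smul_eq_mul] at hstep ⊢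
  rw [err_apply, err_apply, hstep]
  ring

variable (M) in
/-- Deviation of the error from the delay-free system `e(k) = F(k-1) e(k-1)`. -/
noncomputable def dev (x : Fin N → ℤ → Ω → EuclideanSpace ℝ (Fin n)) (k : ℤ) (ω : Ω) :
    EuclideanSpace ℝ (Fin N × Fin n) :=
  M.err x k ω - ap (M.F (k - 1) ω) (M.err x (k - 1) ω)

variable (M) in
/-- The part of the deviation at time `k + 1` that is due to former deviations. -/
noncomputable def devDelay (x : Fin N → ℤ → Ω → EuclideanSpace ℝ (Fin n)) (k : ℕ) (ω : Ω) :
    EuclideanSpace ℝ (Fin N × Fin n) :=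
  ∑ q ∈ Finset.range d, ap (M.C (q + 1) k ω) (M.dev x ((k : ℤ) - q) ω)

/-- The equation for `C_{q+1}(k) F(k-q-1)` turns each summand of `devDelay` into a difference of
consecutive terms plus the delayed consensus term. The differences telescope to `C_1(k) e(k)`, as
`C_{d+1}(k) = 0`, and the first equation merges this with `F(k) e(k)`. -/
theorem IsEstimate.dev_succ (hx : M.IsEstimate x) (k : ℕ) (ω : Ω)
    (hF : ∀ j, IsUnit (M.F j ω)) :
    M.dev x ((k : ℤ) + 1) ω = M.devDelay x k ω + M.a k • ap (M.calH k ω)ᵀ (M.v k ω) := by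
  have hterm : ∀ q ∈ Finset.range d, ap (M.C (q + 1) k ω) (M.dev x ((k : ℤ) - q) ω) =
      (ap (M.C (q + 1) k ω) (M.err x ((k : ℤ) - q) ω)
        - ap (M.C (q + 1 + 1) k ω) (M.err x ((k : ℤ) - ((q + 1 : ℕ) : ℤ)) ω))
      + M.b k • ap (M.Abar k (q + 1) ω) (M.err x (k - ((q + 1 : ℕ) : ℤ)) ω) := by
    intro q hq
    have hq := Finset.mem_range.1 hq
    have h1 := M.C_mul_F_sub (q + 1) (by omega) (by omega) k ω (hF _)
    have e : (k : ℤ) - q - 1 = (k : ℤ) - ((q + 1 : ℕ) : ℤ) := by push_cast; ring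
    rw [dev, ap_sub, e, ← mul_ap, sub_eq_iff_eq_add.1 h1, add_ap, neg_ap, smul_ap]
    abel
  have htel := Finset.sum_range_sub'
    (fun q => ap (M.C (q + 1) k ω) (M.err x ((k : ℤ) - (q : ℤ)) ω)) d
  rw [M.C_of_gt (Nat.lt_succ_self d), zero_ap, sub_zero] at htel
  rw [devDelay, Finset.sum_congr rfl hterm, Finset.sum_add_distrib, htel, ← Finset.smul_sum, dev,
    hx.err_succ, add_sub_cancel_right, ← M.F_add_C_one, add_ap]
  simp only [Nat.cast_zero, sub_zero, zero_add]
  abel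

theorem IsEstimate.err_succ_eq (hx : M.IsEstimate x) (k : ℕ) (ω : Ω)
    (hF : ∀ j, IsUnit (M.F j ω)) :
    M.err x ((k : ℤ) + 1) ω = ap (M.F k ω) (M.err x k ω) + M.devDelay x k ω
      + M.a k • ap (M.calH k ω)ᵀ (M.v k ω) := by
  rw [add_assoc, ← hx.dev_succ k ω hF, dev, add_sub_cancel_right]
  abel

end ErrorRecursion

/-! ### From the supremum condition to a usable `κ` -/

section Gain
variable {M}

/-- Some single `κ` has both bounds above every `b(k)`: the first yields `direct`, the second
`delayed`. The factors `√N` are slack, because `‖Ā‖ ≤ N βa` already. -/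
theorem A3c.exists_smallGain {βa βH Ca : ℝ} (h3c : M.A3c βa βH Ca) (hN : 0 < N) (hβa : 0 < βa)
    (hβH : 0 < βH) (ha : ∀ k, 0 < M.a k) (hb : ∀ k, 0 < M.b k) (hanti : Antitone M.b) :
    ∃ κ, M.SmallGain βa βH κ := by
  obtain ⟨hCa, hsup⟩ := h3c
  obtain ⟨_, ⟨κ, ⟨hκ0, hκ1⟩, rfl⟩, hlt⟩ := exists_lt_of_lt_csSup
    ((Set.nonempty_Ioo.2 one_pos).image _) hsup
  have hbdd : BddAbove (Set.range M.b) := ⟨M.b 0, by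
    rintro _ ⟨k, rfl⟩; exact hanti (Nat.zero_le k)⟩
  have hlt' := fun k => (le_ciSup hbdd k).trans_lt hlt
  have hN' : (1 : ℝ) ≤ N := by exact_mod_cast hN
  have hsq : (1 : ℝ) ≤ √N := Real.one_le_sqrt.2 hN'
  have hCa0 : 0 < Ca := by
    have := (ha 0).trans_le (hCa 0)
    exact pos_of_mul_pos_left this (hb 0).le
  have hNN : (N : ℝ) * βa ≤ N * √N * βa := by
    have := mul_le_mul_of_nonneg_left hsq (show (0 : ℝ) ≤ N * βa by positivity)
    linarith
  refine ⟨κ, hκ0, hκ1, hβa.le, hβH.le, fun k => (ha k).le, fun k => (hb k).le, fun k => ?_,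
    fun k => ?_⟩
  · have h1 := (hlt' k).le.trans (min_le_left _ _)
    rw [le_div_iff₀ (by positivity)] at h1
    have h2 := mul_le_mul_of_nonneg_right (hCa k) (sq_nonneg βH)
    have h3 := mul_le_mul_of_nonneg_left hNN (hb k).le
    linarith
  · have h1 := (hlt' k).le.trans (min_le_right _ _)
    set ρ := (1 - κ)⁻¹ with hρ
    have hρ1 : 1 < ρ := (one_lt_inv₀ (by linarith)).2 (by linarith)
    have hgeom : ∑ s ∈ Finset.range (d + 1), ρ ^ s = (1 - ρ ^ (d + 1)) / (1 - ρ) := by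
      rw [geom_sum_eq hρ1.ne', ← neg_sub, ← neg_sub 1 ρ, neg_div_neg_eq]
    have hle : ∑ s ∈ Finset.range d, ρ ^ (s + 1) ≤ ∑ s ∈ Finset.range (d + 1), ρ ^ s := by
      rw [Finset.sum_range_succ']; simp
    have hpos : 0 < ∑ s ∈ Finset.range (d + 1), ρ ^ s := by
      rw [Finset.sum_range_succ']
      have : 0 ≤ ∑ s ∈ Finset.range d, ρ ^ (s + 1) := Finset.sum_nonneg fun _ _ => by positivity
      simp; linarith
    have hne : 1 - ρ ≠ 0 := by linarith
    have hne2 : 1 - ρ ^ (d + 1) ≠ 0 := by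
      have := one_lt_pow₀ hρ1 (Nat.succ_ne_zero d)
      simp only [Nat.succ_eq_add_one] at this
      linarith
    -- As `ρ > 1`, numerator and denominator both contain a negative factor; their ratio is the
    -- reciprocal of a geometric sum.
    have e : (1 - ρ) * κ / (2 * N * √N * βa * (1 - ((1 - κ) ^ (d + 1))⁻¹))
        = κ / (2 * (N * √N * βa) * ∑ s ∈ Finset.range (d + 1), ρ ^ s) := by
      rw [hgeom, ← inv_pow, ← hρ]
      field_simp
    rw [e, le_div_iff₀ (by positivity)] at h1
    have h2 : M.b k * (N * βa) * ∑ s ∈ Finset.range d, ρ ^ (s + 1)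
        ≤ M.b k * (N * √N * βa) * ∑ s ∈ Finset.range (d + 1), ρ ^ s := by
      have := (hb k).le
      gcongr
    linarith

end Gain

end Network
end DistEst

namespace DistEst

/-! ### Measurability of random matrices -/

section MeasMat
variable {Ω : Type*} {m : MeasurableSpace Ω} {ι κ ν : Type*}

/-- All entries of the random matrix are measurable. -/
def MeasMat (m : MeasurableSpace Ω) (Z : Ω → Matrix ι κ ℝ) : Prop :=
  ∀ i j, Measurable[m] fun ω => Z ω i j

variable {Z W : Ω → Matrix ι κ ℝ}

theorem MeasMat.mono {m' : MeasurableSpace Ω} (h : MeasMat m Z) (hm : m ≤ m') : MeasMat m' Z :=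
  fun i j => (h i j).mono hm le_rfl

theorem MeasMat.const (A : Matrix ι κ ℝ) : MeasMat m fun _ : Ω => A :=
  fun _ _ => measurable_const

theorem MeasMat.add (hZ : MeasMat m Z) (hW : MeasMat m W) : MeasMat m fun ω => Z ω + W ω :=
  fun i j => (hZ i j).add (hW i j)

theorem MeasMat.sub (hZ : MeasMat m Z) (hW : MeasMat m W) : MeasMat m fun ω => Z ω - W ω :=
  fun i j => (hZ i j).sub (hW i j)

theorem MeasMat.smul (c : ℝ) (hZ : MeasMat m Z) : MeasMat m fun ω => c • Z ω :=
  fun i j => (hZ i j).const_mul c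

theorem MeasMat.transpose (hZ : MeasMat m Z) : MeasMat m fun ω => (Z ω)ᵀ :=
  fun i j => hZ j i

theorem MeasMat.mul [Fintype κ] {V : Ω → Matrix κ ν ℝ} (hZ : MeasMat m Z) (hV : MeasMat m V) :
    MeasMat m fun ω => Z ω * V ω := fun i j => by
  simp only [Matrix.mul_apply]
  exact Finset.measurable_sum _ fun k _ => (hZ i k).mul (hV k j)

theorem MeasMat.sum {α : Type*} (s : Finset α) {Y : α → Ω → Matrix ι κ ℝ}
    (h : ∀ a ∈ s, MeasMat m (Y a)) : MeasMat m fun ω => ∑ a ∈ s, Y a ω := fun i j => by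
  simp only [Matrix.sum_apply]
  exact Finset.measurable_sum _ fun a ha => h a ha i j

theorem MeasMat.kronecker_one {α β γ : Type*} [DecidableEq γ] {Y : Ω → Matrix α β ℝ}
    (h : MeasMat m Y) : MeasMat m fun ω => Y ω ⊗ₖ (1 : Matrix γ γ ℝ) := fun i j => by
  simp only [Matrix.kroneckerMap_apply]
  exact (h _ _).mul_const _

theorem MeasMat.measurable_det [Fintype ι] [DecidableEq ι] {Y : Ω → Matrix ι ι ℝ}
    (h : MeasMat m Y) : Measurable fun ω => (Y ω).det := by
  simp only [Matrix.det_apply']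
  exact Finset.measurable_sum _ fun s _ =>
    (Finset.measurable_prod _ fun i _ => h _ _).const_mul _

/-- Cramer's rule: entries are quotients of determinants. With `0⁻¹ = 0` this includes singular
matrices. -/
theorem MeasMat.inv [Fintype ι] [DecidableEq ι] {Y : Ω → Matrix ι ι ℝ}
    (h : MeasMat m Y) : MeasMat m fun ω => (Y ω)⁻¹ := fun i j => by
  simp only [Matrix.inv_def, Ring.inverse_eq_inv', Matrix.smul_apply, smul_eq_mul,
    Matrix.adjugate_apply]
  refine h.measurable_det.inv.mul (MeasMat.measurable_det fun r c => ?_)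
  by_cases hr : r = j
  · subst hr
    simp
  · simpa [Matrix.updateRow_ne hr] using h r c

theorem MeasMat.prodFrom [Fintype ι] [DecidableEq ι] {Y : ℤ → Ω → Matrix ι ι ℝ}
    (h : ∀ j, MeasMat m (Y j)) (i : ℤ) (l : ℕ) :
    MeasMat m fun ω => prodFrom (fun j => Y j ω) i l := by
  induction l with
  | zero => exact MeasMat.const _
  | succ l ih => exact (h _).mul ih

theorem measurable_of_coord [Fintype ι] {f : Ω → EuclideanSpace ℝ ι}
    (h : ∀ i, Measurable fun ω => f ω i) : Measurable f :=
  (WithLp.measurable_toLp 2 _).comp (measurable_pi_lambda (fun ω => (f ω).ofLp) h)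

theorem measurable_coord [Fintype ι] {f : Ω → EuclideanSpace ℝ ι} (hf : Measurable f) (i : ι) :
    Measurable fun ω => f ω i :=
  (measurable_pi_apply i).comp ((WithLp.measurable_ofLp 2 _).comp hf)

theorem MeasMat.measurable_ap [Fintype ι] [Fintype κ] {f : Ω → EuclideanSpace ℝ κ}
    (hZ : MeasMat m Z) (hf : Measurable f) : Measurable fun ω => ap (Z ω) (f ω) := by
  refine measurable_of_coord fun i => ?_
  simp only [ap_apply]
  exact Finset.measurable_sum _ fun j _ => (hZ i j).mul (measurable_coord hf j)

end MeasMat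

/-! ### Conditional centering and independence -/

section Centering
variable {Ω : Type*} [mΩ : MeasurableSpace Ω] {μ : Measure Ω}

/-- If `f` is centered given `m₂`, and `f` and `m₂` are `m₃`-measurable with `m₃` independent of
`m₁`, then `f` is centered given `m₁ ⊔ m₂`. -/
theorem setIntegral_eq_zero_of_indep {m₁ m₂ m₃ : MeasurableSpace Ω} (h₁ : m₁ ≤ mΩ)
    (h₃ : m₃ ≤ mΩ) (h₂₃ : m₂ ≤ m₃) (hind : Indep m₃ m₁ μ) {f : Ω → ℝ} (hf : Measurable[m₃] f)
    (hfi : Integrable f μ) (h0 : ∀ B, MeasurableSet[m₂] B → ∫ ω in B, f ω ∂μ = 0)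
    {s : Set Ω} (hs : MeasurableSet[m₁ ⊔ m₂] s) : ∫ ω in s, f ω ∂μ = 0 := by
  have hle : m₁ ⊔ m₂ ≤ mΩ := sup_le h₁ (h₂₃.trans h₃)
  -- On such a rectangle, independence factors the integral into `μ(A) ∫_B f = 0`; Dynkin's theorem
  -- extends this to `m₁ ⊔ m₂`.
  set P : Set (Set Ω) := {t | ∃ A B, MeasurableSet[m₁] A ∧ MeasurableSet[m₂] B ∧ t = A ∩ B} with hP
  have hgen : m₁ ⊔ m₂ = MeasurableSpace.generateFrom P := by
    refine le_antisymm (sup_le ?_ ?_) (MeasurableSpace.generateFrom_le ?_)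
    · intro A hA
      exact MeasurableSpace.measurableSet_generateFrom
        ⟨A, Set.univ, hA, MeasurableSet.univ, (Set.inter_univ A).symm⟩
    · intro B hB
      exact MeasurableSpace.measurableSet_generateFrom
        ⟨Set.univ, B, MeasurableSet.univ, hB, (Set.univ_inter B).symm⟩
    · rintro _ ⟨A, B, hA, hB, rfl⟩
      exact MeasurableSet.inter ((le_sup_left : m₁ ≤ m₁ ⊔ m₂) _ hA)
        ((le_sup_right : m₂ ≤ m₁ ⊔ m₂) _ hB)
  have hpi : IsPiSystem P := by
    rintro _ ⟨A, B, hA, hB, rfl⟩ _ ⟨A', B', hA', hB', rfl⟩ -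
    exact ⟨A ∩ A', B ∩ B', hA.inter hA', hB.inter hB', Set.inter_inter_inter_comm _ _ _ _⟩
  have huniv : ∫ ω, f ω ∂μ = 0 := by
    simpa using h0 Set.univ MeasurableSet.univ
  induction s, hs using MeasurableSpace.induction_on_inter hgen hpi with
  | empty => simp
  | basic t ht =>
    obtain ⟨A, B, hA, hB, rfl⟩ := ht
    have hB3 := h₂₃ _ hB
    have e : ∫ ω in A ∩ B, f ω ∂μ = ∫ ω, (B.indicator f * A.indicator fun _ => (1 : ℝ)) ω ∂μ := by
      rw [← integral_indicator ((h₁ _ hA).inter (h₃ _ hB3))]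
      refine integral_congr_ae (ae_of_all _ fun ω => ?_)
      by_cases hωA : ω ∈ A <;> by_cases hωB : ω ∈ B <;> simp [hωA, hωB]
    have hBm : Measurable[m₃] (B.indicator f) := hf.indicator hB3
    have hAm : Measurable[m₁] (A.indicator fun _ => (1 : ℝ)) := measurable_const.indicator hA
    have hindf : IndepFun (B.indicator f) (A.indicator fun _ => (1 : ℝ)) μ :=
      (IndepFun_iff_Indep _ _ _).2 (indep_of_indep_of_le hind hBm.comap_le hAm.comap_le)
    rw [e, hindf.integral_mul_eq_mul_integral (hBm.mono h₃ le_rfl).aestronglyMeasurable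
      (hAm.mono h₁ le_rfl).aestronglyMeasurable, integral_indicator (h₃ _ hB3), h0 B hB, zero_mul]
  | compl t htm ih =>
    have := integral_add_compl (hle _ htm) hfi
    rw [ih, huniv, zero_add] at this
    exact this
  | iUnion g hd hgm ih =>
    rw [integral_iUnion (fun i => hle _ (hgm i)) hd hfi.integrableOn]
    simp [ih]

theorem integral_mul_eq_zero_of_setIntegral [IsProbabilityMeasure μ] {m : MeasurableSpace Ω} (hm : m ≤ mΩ) {f g : Ω → ℝ}
    (hf : Integrable f μ) (h0 : ∀ s, MeasurableSet[m] s → ∫ ω in s, f ω ∂μ = 0)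
    (hg : Measurable[m] g) (hgf : Integrable (g * f) μ) : ∫ ω, g ω * f ω ∂μ = 0 := by
  have hc : μ[f|m] =ᵐ[μ] 0 := by
    refine (ae_eq_condExp_of_forall_setIntegral_eq hm hf (fun _ _ _ => integrableOn_zero)
      (fun s hs _ => ?_) aestronglyMeasurable_zero).symm
    rw [h0 s hs]; simp
  have hp := condExp_mul_of_stronglyMeasurable_left hg.stronglyMeasurable hgf hf
  have e : ∫ ω, (g * f) ω ∂μ = 0 := by
    rw [← integral_condExp hm]
    refine integral_eq_zero_of_ae ?_
    filter_upwards [hp, hc] with ω h1 h2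
    simp [h1, h2]
  exact e

end Centering

namespace Network

variable {Ω : Type*} [mΩ : MeasurableSpace Ω] {μ : Measure Ω} {N n d : ℕ} (M : Network Ω μ N n d)

/-! ### Adaptedness of the error, and orthogonality of the noise -/

section Sigma

/-- σ-field of the graphs, observation matrices and delays at all times. -/
@[reducible] def sigmaEnvAll : MeasurableSpace Ω := ⨆ s, M.sigmaEnv s

/-- σ-field of the noises before time `k`. -/
@[reducible] def sigmaNoiseLT (k : ℕ) : MeasurableSpace Ω := ⨆ s : ℕ, ⨆ _ : s < k, M.sigmaNoise s

theorem sigmaEnv_le (s : ℕ) : M.sigmaEnv s ≤ mΩ :=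
  sup_le (sup_le (iSup_le fun i => iSup_le fun j => (M.measurable_A s i j).comap_le)
    (iSup_le fun i => iSup_le fun r => iSup_le fun c => (M.measurable_H i s r c).comap_le))
    (iSup_le fun j => iSup_le fun i => (M.measurable_delay s j i).comap_le)

theorem sigmaNoise_le (s : ℕ) : M.sigmaNoise s ≤ mΩ := (M.measurable_v s).comap_le

theorem sigmaF_le (k : ℤ) : M.sigmaF k ≤ mΩ :=
  iSup_le fun s => iSup_le fun _ => sup_le (M.sigmaEnv_le s) (M.sigmaNoise_le s)

theorem sigmaEnvAll_le : M.sigmaEnvAll ≤ mΩ := iSup_le M.sigmaEnv_le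

theorem sigmaF_mono {k l : ℤ} (h : k ≤ l) : M.sigmaF k ≤ M.sigmaF l :=
  iSup_le fun s => iSup_le fun hs =>
    le_iSup₂_of_le (f := fun (s : ℕ) (_ : (s : ℤ) ≤ l) => M.sigmaEnv s ⊔ M.sigmaNoise s)
      s (hs.trans h) le_rfl

theorem sigmaEnv_le_sigmaF {s : ℕ} {k : ℤ} (h : (s : ℤ) ≤ k) : M.sigmaEnv s ≤ M.sigmaF k :=
  le_iSup₂_of_le (f := fun (s : ℕ) (_ : (s : ℤ) ≤ k) => M.sigmaEnv s ⊔ M.sigmaNoise s)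
    s h le_sup_left

theorem sigmaNoise_le_sigmaF {s : ℕ} {k : ℤ} (h : (s : ℤ) ≤ k) : M.sigmaNoise s ≤ M.sigmaF k :=
  le_iSup₂_of_le (f := fun (s : ℕ) (_ : (s : ℤ) ≤ k) => M.sigmaEnv s ⊔ M.sigmaNoise s)
    s h le_sup_right

theorem sigmaNoiseLT_le_sigmaF (k : ℕ) : M.sigmaNoiseLT k ≤ M.sigmaF ((k : ℤ) - 1) :=
  iSup_le fun s => iSup_le fun hs => M.sigmaNoise_le_sigmaF (by omega)

theorem sigmaF_le_sup (k : ℕ) : M.sigmaF ((k : ℤ) - 1) ≤ M.sigmaEnvAll ⊔ M.sigmaNoiseLT k :=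
  iSup_le fun s => iSup_le fun hs => sup_le_sup (le_iSup M.sigmaEnv s)
    (le_iSup₂_of_le (f := fun (s : ℕ) (_ : s < k) => M.sigmaNoise s) s (by omega) le_rfl)

theorem measurable_A_env (k : ℕ) (i j : Fin N) :
    Measurable[M.sigmaEnv k] fun ω => M.A k ω i j :=
  Measurable.mono (comap_measurable _) (le_sup_of_le_left (le_sup_of_le_left
    (le_iSup₂ (f := fun i j => MeasurableSpace.comap (fun ω => M.A k ω i j) inferInstance) i j)))
    le_rfl

theorem measurable_H_env (k : ℕ) (i : Fin N) (r : Fin (M.p i)) (c : Fin n) :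
    Measurable[M.sigmaEnv k] fun ω => M.H i k ω r c :=
  Measurable.mono (comap_measurable _) (le_sup_of_le_left (le_sup_of_le_right
    (le_iSup_of_le i (le_iSup₂ (f := fun r c =>
      MeasurableSpace.comap (fun ω => M.H i k ω r c) inferInstance) r c)))) le_rfl

theorem measurable_delay_env (k : ℕ) (j i : Fin N) :
    Measurable[M.sigmaEnv k] (M.delay k j i) :=
  Measurable.mono (comap_measurable _) (le_sup_of_le_right
    (le_iSup₂ (f := fun j i => MeasurableSpace.comap (M.delay k j i) inferInstance) j i)) le_rfl

theorem measMat_calH (k : ℕ) : MeasMat (M.sigmaEnv k) (M.calH k) := by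
  rintro ⟨i, r⟩ ⟨j, c⟩
  simp only [calH, Matrix.of_apply]
  split_ifs
  · exact M.measurable_H_env k i r c
  · exact measurable_const

theorem measMat_A (k : ℕ) : MeasMat (M.sigmaEnv k) (M.A k) := M.measurable_A_env k

theorem measMat_degMat (k : ℕ) : MeasMat (M.sigmaEnv k) (M.degMat k) := by
  intro i j
  simp only [degMat, Matrix.diagonal_apply]
  split_ifs
  · exact Finset.measurable_sum _ fun j _ => M.measurable_A_env k i j
  · exact measurable_const

theorem measMat_Abar (k q : ℕ) : MeasMat (M.sigmaEnv k) (M.Abar k q) := by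
  refine MeasMat.kronecker_one fun i j => ?_
  simp only [Matrix.hadamard_apply, delayMat, Matrix.of_apply]
  refine (M.measurable_A_env k i j).mul ?_
  exact (measurable_of_countable fun l : Fin (d + 1) =>
    if (l : ℕ) = q then (1 : ℝ) else 0).comp (M.measurable_delay_env k j i)

theorem measMat_sysMat (k : ℕ) : MeasMat (M.sigmaEnv k) (M.sysMat k) :=
  (((MeasMat.const 1).sub ((M.measMat_degMat k).kronecker_one.smul _)).sub
    (((M.measMat_calH k).transpose.mul (M.measMat_calH k)).smul _)).add
    ((M.measMat_Abar k 0).smul _)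

theorem measMat_backC (k : ℕ) {P : Ω → ℤ → Matrix (Fin N × Fin n) (Fin N × Fin n) ℝ}
    (hP : ∀ j, MeasMat M.sigmaEnvAll fun ω => P ω j) (t : ℕ) :
    MeasMat M.sigmaEnvAll fun ω => M.backC k ω (P ω) t := by
  induction t with
  | zero => exact MeasMat.const _
  | succ t ih =>
    exact (ih.sub (((M.measMat_Abar k (d - t)).mono (le_iSup M.sigmaEnv k)).smul _)).mul
      (hP _).inv

/-- No noise enters `F`. The σ-field of the environment at all times suffices, as the noise is
independent of all of it. -/
theorem measMat_F (j : ℤ) : MeasMat M.sigmaEnvAll (M.F j) := by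
  have h : ∀ (k : ℕ) (j : ℤ), MeasMat M.sigmaEnvAll fun ω => M.Fhist ω k j := by
    intro k
    induction k with
    | zero => exact fun j => MeasMat.const _
    | succ k ih =>
      intro j
      by_cases hj : j = k
      · subst hj
        simp only [Fhist, Function.update_self]
        exact ((M.measMat_sysMat k).mono (le_iSup M.sigmaEnv k)).sub (M.measMat_backC k ih d)
      · simp only [Fhist, Function.update_of_ne hj]
        exact ih j
  exact h _ j

theorem measMat_C (q k : ℕ) : MeasMat M.sigmaEnvAll (M.C q k) := by
  unfold C
  split_ifs
  · exact MeasMat.const _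
  · exact M.measMat_backC k M.measMat_F _

theorem measMat_delayTerm (k q : ℕ) : MeasMat M.sigmaEnvAll (M.delayTerm k q) :=
  ((M.measMat_Abar k q).mono (le_iSup M.sigmaEnv k)).mul
    ((MeasMat.prodFrom M.measMat_F _ _).inv.sub (MeasMat.const _))

variable {M}

/-- The shift by one matters: the error at time `mh` is known given `ℱ(mh-1)`, the σ-field in the
excitation. -/
theorem IsEstimate.measurable_err {x : Fin N → ℤ → Ω → EuclideanSpace ℝ (Fin n)}
    (hx : M.IsEstimate x) (k : ℤ) (hk : -(d : ℤ) ≤ k) :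
    Measurable[M.sigmaF (k - 1)] (M.err x k) := by
  obtain ⟨ξ, hξ⟩ := hx.initial
  have hconst : ∀ j : ℤ, -(d : ℤ) ≤ j → j ≤ 0 → ∃ y, M.err x j = fun _ => y := by
    intro j h1 h2
    refine ⟨WithLp.toLp 2 fun ic => ξ ic.1 j ic.2 - M.x₀ ic.2, ?_⟩
    funext ω
    simp only [err, hξ _ j h1 h2]
  have hneg : ∀ (j i : ℤ), -(d : ℤ) ≤ j → j ≤ 0 → Measurable[M.sigmaF i] (M.err x j) := by
    intro j i h1 h2
    obtain ⟨y, hy⟩ := hconst j h1 h2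
    rw [hy]
    exact measurable_const
  rcases le_or_gt k 0 with h | h
  · exact hneg k _ hk h
  obtain ⟨k, rfl⟩ : ∃ l : ℕ, k = (l : ℤ) + 1 := ⟨(k - 1).toNat, by omega⟩
  clear hk h
  induction k using Nat.strong_induction_on with
  | _ k ih =>
    have hF : M.sigmaF ((k : ℤ) + 1 - 1) = M.sigmaF k := by simp
    have hpast : ∀ j : ℤ, -(d : ℤ) ≤ j → j ≤ k → Measurable[M.sigmaF k] (M.err x j) := by
      intro j h1 h2
      rcases le_or_gt j 0 with h | h
      · exact hneg j _ h1 h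
      · obtain ⟨l, rfl⟩ : ∃ l : ℕ, j = (l : ℤ) + 1 := ⟨(j - 1).toNat, by omega⟩
        exact (ih l (by omega)).mono (M.sigmaF_mono (by omega)) le_rfl
    have henv : M.sigmaEnv k ≤ M.sigmaF k := M.sigmaEnv_le_sigmaF le_rfl
    have hv : Measurable[M.sigmaF k] (M.v k) :=
      (comap_measurable (M.v k)).mono (M.sigmaNoise_le_sigmaF le_rfl) le_rfl
    rw [hF, funext (hx.err_succ k)]
    refine Measurable.add (Measurable.add ?_ ?_) ?_
    · exact ((M.measMat_sysMat k).mono henv).measurable_ap (hpast k (by omega) le_rfl)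
    · refine Measurable.fun_const_smul (Finset.measurable_sum _ fun q hq => ?_) _
      have := Finset.mem_range.1 hq
      exact ((M.measMat_Abar k (q + 1)).mono henv).measurable_ap (hpast _ (by omega) (by omega))
    · exact (((M.measMat_calH k).mono henv).transpose.measurable_ap hv).fun_const_smul _

/-- The noise is orthogonal to everything that depends on the past noise and on the environment. -/
theorem integral_inner_v_eq_zero [IsProbabilityMeasure μ] (h1a : M.A1a) {βv : ℝ} (h1b : M.A1b βv)
    (k : ℕ) {g : Ω → EuclideanSpace ℝ (Σ i : Fin N, Fin (M.p i))} (hg2 : MemLp g 2 μ)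
    (hg : Measurable[M.sigmaEnvAll ⊔ M.sigmaNoiseLT k] g) :
    ∫ ω, inner ℝ (g ω) (M.v k ω) ∂μ = 0 := by
  obtain ⟨-, hv2, hv0, -⟩ := h1b
  have hN3 : (⨆ s, M.sigmaNoise s) ≤ mΩ := iSup_le M.sigmaNoise_le
  have hcoord : ∀ {f : Ω → EuclideanSpace ℝ (Σ i : Fin N, Fin (M.p i))}, MemLp f 2 μ →
      ∀ i, MemLp (fun ω => f ω i) 2 μ := by
    intro f hf i
    refine hf.of_le ((EuclideanSpace.proj (𝕜 := ℝ) i).continuous.comp_aestronglyMeasurable hf.1)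
      (ae_of_all _ fun ω => PiLp.norm_apply_le (f ω) i)
  have hvi : Integrable (M.v k) μ := (hv2 k).integrable (by norm_num)
  have hterm : ∀ i, ∫ ω, g ω i * M.v k ω i ∂μ = 0 := by
    intro i
    refine integral_mul_eq_zero_of_setIntegral (m := M.sigmaEnvAll ⊔ M.sigmaNoiseLT k)
      (sup_le M.sigmaEnvAll_le ((M.sigmaNoiseLT_le_sigmaF k).trans (M.sigmaF_le _)))
      ((hcoord (hv2 k) i).integrable (by norm_num)) (fun s hs => ?_) (measurable_coord hg i)
      ((hcoord hg2 i).integrable_mul (hcoord (hv2 k) i))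
    -- The martingale property centers `v(k)` given `ℱ(k-1)` only, which lacks the environment at
    -- time `k`. Centering given past noise, plus independence of the environment, fills the gap.
    refine setIntegral_eq_zero_of_indep M.sigmaEnvAll_le hN3
      (iSup_le fun s => iSup_le fun _ => le_iSup M.sigmaNoise s) h1a
      (measurable_coord ((comap_measurable (M.v k)).mono (le_iSup M.sigmaNoise k) le_rfl) i)
      ((hcoord (hv2 k) i).integrable (by norm_num)) (fun B hB => ?_) hs
    have hB' := M.sigmaNoiseLT_le_sigmaF k _ hB
    have e1 : ∫ ω in B, M.v k ω ∂μ = 0 := by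
      rw [← setIntegral_condExp (M.sigmaF_le _) hvi hB',
        integral_congr_ae (ae_restrict_of_ae (hv0 k))]
      simp
    have e2 := (EuclideanSpace.proj (𝕜 := ℝ) i :
      EuclideanSpace ℝ (Σ i : Fin N, Fin (M.p i)) →L[ℝ] ℝ).integral_comp_comm
      (hvi.restrict (s := B))
    rw [e1, map_zero] at e2
    exact e2
  have e : ∀ ω, inner ℝ (g ω) (M.v k ω) = ∑ i, g ω i * M.v k ω i := by
    intro ω
    simp [PiLp.inner_apply, mul_comm]
  simp only [e]
  have hint : ∀ i, Integrable (fun ω => g ω i * M.v k ω i) μ := fun i =>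
    (hcoord hg2 i).integrable_mul (hcoord (hv2 k) i)
  rw [integral_finsetSum _ fun i _ => hint i]
  simp [hterm]

end Sigma
end Network
end DistEst

namespace DistEst

/-! ### Random matrices acting on `L²` vectors -/

section ApLp
open scoped Matrix.Norms.L2Operator
variable {Ω : Type*} [mΩ : MeasurableSpace Ω] {μ : Measure Ω} {ι κ : Type*} [Fintype ι] [Fintype κ]
  [DecidableEq κ]

theorem MeasMat.memLp_ap {Z : Ω → Matrix ι κ ℝ} (hZ : MeasMat mΩ Z) {c : ℝ} (hc : 0 ≤ c)
    (hbd : ∀ᵐ ω ∂μ, ‖Z ω‖ ≤ c) {f : Ω → EuclideanSpace ℝ κ} (hf : MemLp f 2 μ) :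
    MemLp (fun ω => ap (Z ω) (f ω)) 2 μ ∧
      lpNorm (fun ω => ap (Z ω) (f ω)) 2 μ ≤ c * lpNorm f 2 μ := by
  refine lpNorm_le_mul_of_ae ?_ hf hc ?_
  · refine ⟨fun ω => ap (Z ω) (hf.1.mk f ω),
      (hZ.measurable_ap hf.1.stronglyMeasurable_mk.measurable).stronglyMeasurable, ?_⟩
    filter_upwards [hf.1.ae_eq_mk] with ω h
    rw [h]
  · filter_upwards [hbd] with ω h
    exact (norm_ap_le _ _).trans (mul_le_mul_of_nonneg_right h (norm_nonneg _))

theorem lpNorm_two_congr {E : Type*} [NormedAddCommGroup E] {f g : Ω → E} (h : f =ᵐ[μ] g)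
    (hg : MemLp g 2 μ) : lpNorm f 2 μ = lpNorm g 2 μ := by
  rw [← toReal_eLpNorm (hg.1.congr h.symm), ← toReal_eLpNorm hg.1, eLpNorm_congr_ae h]

end ApLp

namespace Network

variable {Ω : Type*} [mΩ : MeasurableSpace Ω] {μ : Measure Ω} {N n d : ℕ} (M : Network Ω μ N n d)

/-! ### Uniform bounds, and smallness of the deviations in `L²` -/

section Regular
open scoped Matrix.Norms.L2Operator

/-- Almost sure and mean square bounds of the equivalent system, with one constant `K`. -/
structure Regular (K : ℝ) : Prop where
  one_le : 1 ≤ K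
  isUnit_F : ∀ᵐ ω ∂μ, ∀ j, IsUnit (M.F j ω)
  norm_F : ∀ᵐ ω ∂μ, ∀ j, ‖M.F j ω‖ ≤ K
  norm_inv_F : ∀ᵐ ω ∂μ, ∀ j, ‖(M.F j ω)⁻¹‖ ≤ K
  norm_one_sub_F : ∀ᵐ ω ∂μ, ∀ k : ℕ, ‖1 - M.F k ω‖ ≤ K * M.b k
  norm_C : ∀ᵐ ω ∂μ, ∀ q k, ‖M.C q k ω‖ ≤ K * M.b k
  norm_calH : ∀ᵐ ω ∂μ, ∀ k, ‖M.calH k ω‖ ≤ K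
  norm_sysMat : ∀ᵐ ω ∂μ, ∀ k, ‖M.sysMat k ω‖ ≤ K
  norm_Abar : ∀ᵐ ω ∂μ, ∀ k q, ‖M.Abar k q ω‖ ≤ K
  abs_A : ∀ᵐ ω ∂μ, ∀ k i j, |M.A k ω i j| ≤ K
  memLp_v : ∀ k, MemLp (M.v k) 2 μ
  lpNorm_v : ∀ k, lpNorm (M.v k) 2 μ ≤ K
  a_le : ∀ k, M.a k ≤ K * M.b k

variable {M}

theorem A1b.lpNorm_v_le [IsProbabilityMeasure μ] {βv : ℝ} (h : M.A1b βv) (k : ℕ) :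
    lpNorm (M.v k) 2 μ ≤ √βv := by
  obtain ⟨-, h2, -, hc⟩ := h
  refine Real.le_sqrt_of_sq_le ?_
  rw [sq_lpNorm_two (h2 k), ← integral_condExp (M.sigmaF_le ((k : ℤ) - 1))]
  refine (integral_mono_ae integrable_condExp (integrable_const βv)
    (hc.mono fun ω h => h k)).trans ?_
  simp

theorem exists_regular [IsProbabilityMeasure μ] {βv βa βH Ca : ℝ} (hN : 0 < N) (h1b : M.A1b βv)
    (h2b : M.A2b βa βH) (h3a : M.A3a) (h3c : M.A3c βa βH Ca) : ∃ K, M.Regular K := by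
  obtain ⟨hβa, hβH, hA, hH⟩ := h2b
  obtain ⟨ha, hb, -, hbanti, -⟩ := h3a
  obtain ⟨κ, hs⟩ := h3c.exists_smallGain hN hβa hβH ha hb hbanti
  have hgood : ∀ᵐ ω ∂μ, M.BoundedAt βa βH ω := by
    filter_upwards [hA, hH] with ω h1 h2 using ⟨h1, h2⟩
  set cC := N * βa * ∑ s ∈ Finset.range d, ((1 - κ)⁻¹) ^ (s + 1)
  set cG := N * βa + N * βa + Ca * βH ^ 2 + cC
  -- Any common upper bound would do; the `2` covers `‖F‖ ≤ 1 + κ` and `‖sysMat‖ ≤ 1 + κ / 2`.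
  set K := 2 + |(1 - κ)⁻¹| + |cC| + |cG| + |βH| + |N * βa| + |βa| + |√βv| + |Ca| with hK
  have p1 := abs_nonneg (1 - κ)⁻¹
  have p2 := abs_nonneg cC
  have p3 := abs_nonneg cG
  have p4 := abs_nonneg βH
  have p5 := abs_nonneg (N * βa)
  have p6 := abs_nonneg βa
  have p7 := abs_nonneg √βv
  have p8 := abs_nonneg Ca
  have hκ := hs.lt_one
  refine ⟨K, ?_, ?_, ?_, ?_, ?_, ?_, ?_, ?_, ?_, ?_, h1b.2.1, fun k => ?_, fun k => ?_⟩
  · linarith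
  · filter_upwards [hgood] with ω h j using h.isUnit_F hs j
  · filter_upwards [hgood] with ω h j
    have h1 := h.norm_F_sub_one_le hs j
    have h2 := norm_add_le (M.F j ω - 1) 1
    have h3 := l2_opNorm_one_le (κ := Fin N × Fin n)
    rw [sub_add_cancel] at h2
    linarith
  · filter_upwards [hgood] with ω h j
    have h1 := h.norm_inv_F_le hs j
    linarith [le_abs_self (1 - κ)⁻¹]
  · filter_upwards [hgood] with ω h k
    exact (h.norm_one_sub_F_le hs h3c.1 k).trans
      (mul_le_mul_of_nonneg_right (by linarith [le_abs_self cG]) (hb k).le)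
  · filter_upwards [hgood] with ω h q k
    exact (h.norm_C_le hs q k).trans
      (mul_le_mul_of_nonneg_right (by linarith [le_abs_self cC]) (hb k).le)
  · filter_upwards [hgood] with ω h k
    exact (h.norm_calH_le hβH.le k).trans (by linarith [le_abs_self βH])
  · filter_upwards [hgood] with ω h k
    have h1 := (h.norm_one_sub_sysMat_le hs k).trans (hs.direct k)
    have h2 := norm_sub_le 1 (1 - M.sysMat k ω)
    have h3 := l2_opNorm_one_le (κ := Fin N × Fin n)
    rw [sub_sub_cancel] at h2
    linarith
  · filter_upwards [hgood] with ω h k q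
    exact (h.norm_Abar_le hβa.le k q).trans (by linarith [le_abs_self (N * βa)])
  · filter_upwards [hgood] with ω h k i j
    exact (h.1 k i j).trans (by linarith [le_abs_self βa])
  · exact (h1b.lpNorm_v_le k).trans (by linarith [le_abs_self √βv])
  · exact (h3c.1 k).trans
      (mul_le_mul_of_nonneg_right (by linarith [le_abs_self Ca]) (hb k).le)

/-- The asymptotic bound holds at all times after enlarging the constant, because `a` never
vanishes. -/
theorem A3a.exists_a_le (h3a : M.A3a) (m : ℕ) : ∃ R, 0 ≤ R ∧ ∀ k, M.a k ≤ R * M.a (k + m) := by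
  obtain ⟨ha, -, -, -, -, -, -, hO, -⟩ := h3a
  rcases Nat.eq_zero_or_pos m with rfl | hm
  · exact ⟨1, zero_le_one, fun k => by simp⟩
  obtain ⟨R, hR, h⟩ := bound_of_isBigO_nat_atTop (hO m hm)
  refine ⟨R, hR.le, fun k => ?_⟩
  have := h (x := k) (ha _).ne'
  rwa [Real.norm_of_nonneg (ha _).le, Real.norm_of_nonneg (ha _).le] at this

variable {K : ℝ} {x : Fin N → ℤ → Ω → EuclideanSpace ℝ (Fin n)}

theorem measMat_F_ambient (j : ℤ) : MeasMat mΩ (M.F j) := (M.measMat_F j).mono M.sigmaEnvAll_le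

theorem measMat_one_sub_F (k : ℤ) : MeasMat mΩ fun ω => 1 - M.F k ω :=
  (MeasMat.const 1).sub (measMat_F_ambient k)

theorem Regular.memLp_calH_v (hr : M.Regular K) (k : ℕ) :
    MemLp (fun ω => ap (M.calH k ω)ᵀ (M.v k ω)) 2 μ ∧
      lpNorm (fun ω => ap (M.calH k ω)ᵀ (M.v k ω)) 2 μ ≤ K * K := by
  have h0 : 0 ≤ K := zero_le_one.trans hr.one_le
  have h := ((M.measMat_calH k).mono (M.sigmaEnv_le k)).transpose.memLp_ap (μ := μ) h0
    (hr.norm_calH.mono fun ω h => by rw [l2_opNorm_transpose]; exact h k) (hr.memLp_v k)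
  exact ⟨h.1, h.2.trans (mul_le_mul_of_nonneg_left (hr.lpNorm_v k) h0)⟩

theorem Regular.memLp_err [IsProbabilityMeasure μ] (hr : M.Regular K) (hx : M.IsEstimate x) (k : ℤ)
    (hk : -(d : ℤ) ≤ k) : MemLp (M.err x k) 2 μ := by
  have h0 : 0 ≤ K := zero_le_one.trans hr.one_le
  obtain ⟨ξ, hξ⟩ := hx.initial
  have hneg : ∀ j : ℤ, -(d : ℤ) ≤ j → j ≤ 0 → MemLp (M.err x j) 2 μ := by
    intro j h1 h2
    have e : M.err x j = fun _ => WithLp.toLp 2 fun ic => ξ ic.1 j ic.2 - M.x₀ ic.2 := by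
      funext ω
      simp only [err, hξ _ j h1 h2]
    rw [e]
    exact memLp_const _
  rcases le_or_gt k 0 with h | h
  · exact hneg k hk h
  obtain ⟨k, rfl⟩ : ∃ l : ℕ, k = (l : ℤ) + 1 := ⟨(k - 1).toNat, by omega⟩
  clear hk h
  induction k using Nat.strong_induction_on with
  | _ k ih =>
    have hpast : ∀ j : ℤ, -(d : ℤ) ≤ j → j ≤ k → MemLp (M.err x j) 2 μ := by
      intro j h1 h2
      rcases le_or_gt j 0 with h | h
      · exact hneg j h1 h
      · obtain ⟨l, rfl⟩ : ∃ l : ℕ, j = (l : ℤ) + 1 := ⟨(j - 1).toNat, by omega⟩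
        exact ih l (by omega)
    have h1 : MemLp (fun ω => ap (M.sysMat k ω) (M.err x k ω)) 2 μ :=
       (((M.measMat_sysMat k).mono (M.sigmaEnv_le k)).memLp_ap h0
        (hr.norm_sysMat.mono fun ω h => h k) (hpast k (by omega) le_rfl)).1
    have h2 : MemLp (fun ω => ∑ q ∈ Finset.range d,
        ap (M.Abar k (q + 1) ω) (M.err x (k - ((q + 1 : ℕ) : ℤ)) ω)) 2 μ := by
      refine memLp_finsetSum _ fun q hq => ?_
      have := Finset.mem_range.1 hq
      exact (((M.measMat_Abar k (q + 1)).mono (M.sigmaEnv_le k)).memLp_ap h0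
        (hr.norm_Abar.mono fun ω h => h k (q + 1)) (hpast _ (by omega) (by omega))).1
    rw [funext (hx.err_succ k)]
    exact (h1.add (h2.const_smul (M.b k))).add ((hr.memLp_calH_v k).1.const_smul (M.a k))

theorem Regular.memLp_dev [IsProbabilityMeasure μ] (hr : M.Regular K) (hx : M.IsEstimate x) (k : ℤ)
    (hk : -(d : ℤ) < k) : MemLp (M.dev x k) 2 μ :=
  (hr.memLp_err hx k hk.le).sub ((measMat_F_ambient (k - 1)).memLp_ap (zero_le_one.trans hr.one_le)
    (hr.norm_F.mono fun ω h => h (k - 1)) (hr.memLp_err hx (k - 1) (by omega))).1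

theorem Regular.memLp_devDelay [IsProbabilityMeasure μ] (hr : M.Regular K) (hx : M.IsEstimate x)
    (hb : ∀ k, 0 ≤ M.b k) (k : ℕ) :
    MemLp (M.devDelay x k) 2 μ ∧ lpNorm (M.devDelay x k) 2 μ ≤
      K * M.b k * ∑ q ∈ Finset.range d, lpNorm (M.dev x ((k : ℤ) - q)) 2 μ := by
  have h0 : 0 ≤ K * M.b k := mul_nonneg (zero_le_one.trans hr.one_le) (hb k)
  have h : ∀ q ∈ Finset.range d,
      MemLp (fun ω => ap (M.C (q + 1) k ω) (M.dev x ((k : ℤ) - q) ω)) 2 μ ∧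
      lpNorm (fun ω => ap (M.C (q + 1) k ω) (M.dev x ((k : ℤ) - q) ω)) 2 μ ≤
        K * M.b k * lpNorm (M.dev x ((k : ℤ) - q)) 2 μ := by
    intro q hq
    have := Finset.mem_range.1 hq
    exact ((M.measMat_C (q + 1) k).mono M.sigmaEnvAll_le).memLp_ap h0
      (hr.norm_C.mono fun ω h => h (q + 1) k) (hr.memLp_dev hx _ (by omega))
  refine ⟨memLp_finsetSum _ fun q hq => (h q hq).1, ?_⟩
  refine (lpNorm_two_sum_le _ fun q hq => (h q hq).1).trans ?_
  rw [Finset.mul_sum]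
  exact Finset.sum_le_sum fun q hq => (h q hq).2

/-- The triangle inequality in `dev_succ` is enough: past deviations enter with gain `O(b)`, the
noise with size `O(a)`. -/
theorem Regular.exists_lpNorm_dev_le [IsProbabilityMeasure μ] (hr : M.Regular K)
    (hx : M.IsEstimate x) (h3a : M.A3a) :
    ∃ K', 0 ≤ K' ∧ ∀ k : ℕ, lpNorm (M.dev x k) 2 μ ≤ K' * M.a k := by
  -- The gain at time `k - q`, `q ≤ d`, is compared with that at `k + 1`.
  obtain ⟨R, hR, haR⟩ := h3a.exists_a_le (d + 1)
  obtain ⟨ha, hb, haanti, -, -, hblim, -⟩ := h3a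
  have h1 := hr.one_le
  have h0 : 0 ≤ K := zero_le_one.trans h1
  refine exists_bound_of_delay_recursion (b := M.b) (d := d) (K := K * K) (R := R)
    ha (fun k => (hb k).le) hblim (by positivity) hR (fun k q hq hqk => ?_) fun k hk => ?_
  · refine (haR (k - q)).trans (mul_le_mul_of_nonneg_left (haanti (by omega)) hR)
  · have e : M.dev x ((k + 1 : ℕ) : ℤ) =ᵐ[μ]
        M.devDelay x k + M.a k • fun ω => ap (M.calH k ω)ᵀ (M.v k ω) := by
      filter_upwards [hr.isUnit_F] with ω h
      push_cast
      exact hx.dev_succ k ω h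
    have hD := hr.memLp_devDelay hx (fun k => (hb k).le) k
    have hV := hr.memLp_calH_v k
    rw [lpNorm_two_congr e (hD.1.add (hV.1.const_smul (M.a k)))]
    refine (lpNorm_add_le hD.1 (by norm_num)).trans (add_le_add (hD.2.trans ?_) ?_)
    · have e2 : ∀ q ∈ Finset.range d, lpNorm (M.dev x ((k : ℤ) - q)) 2 μ =
          lpNorm (M.dev x ((k - q : ℕ) : ℤ)) 2 μ := by
        intro q hq
        have := Finset.mem_range.1 hq
        rw [Nat.cast_sub (by omega)]
      rw [Finset.sum_congr rfl e2]
      refine mul_le_mul_of_nonneg_right (mul_le_mul_of_nonneg_right ?_ (hb k).le)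
        (Finset.sum_nonneg fun _ _ => lpNorm_nonneg)
      nlinarith
    · rw [lpNorm_const_smul, coe_nnnorm, Real.norm_of_nonneg (ha k).le, mul_comm]
      exact mul_le_mul_of_nonneg_right hV.2 (ha k).le

/-- The factor `C_q(k) = O(b(k))` improves the `O(a)` of the deviations by one order. This part is
correlated with the error, so its size must suffice. -/
theorem Regular.exists_lpNorm_devDelay_le [IsProbabilityMeasure μ] (hr : M.Regular K)
    (hx : M.IsEstimate x) (h3a : M.A3a) :
    ∃ K', 0 ≤ K' ∧ ∀ k : ℕ, d ≤ k → lpNorm (M.devDelay x k) 2 μ ≤ K' * (M.a k * M.b k) := by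
  obtain ⟨K₁, hK₁, hdev⟩ := hr.exists_lpNorm_dev_le hx h3a
  obtain ⟨R, hR, haR⟩ := h3a.exists_a_le d
  obtain ⟨ha, hb, haanti, -⟩ := h3a
  have h0 : 0 ≤ K := zero_le_one.trans hr.one_le
  refine ⟨K * (d * (K₁ * R)), by positivity, fun k hk => ?_⟩
  refine (hr.memLp_devDelay hx (fun k => (hb k).le) k).2.trans ?_
  have h : ∑ q ∈ Finset.range d, lpNorm (M.dev x ((k : ℤ) - q)) 2 μ ≤ d * (K₁ * (R * M.a k)) := by
    calc _ ≤ ∑ _q ∈ Finset.range d, K₁ * (R * M.a k) := by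
          refine Finset.sum_le_sum fun q hq => ?_
          have := Finset.mem_range.1 hq
          have e : (k : ℤ) - q = ((k - q : ℕ) : ℤ) := by rw [Nat.cast_sub (by omega)]
          rw [e]
          refine (hdev _).trans (mul_le_mul_of_nonneg_left ?_ hK₁)
          exact (haR _).trans (mul_le_mul_of_nonneg_left (haanti (by omega)) hR)
      _ = _ := by simp
  have := mul_le_mul_of_nonneg_left h (mul_nonneg h0 (hb k).le)
  linarith

end Regular
end Network
end DistEst

namespace DistEst

/-! ### The minimum eigenvalue as a lower bound of the quadratic form -/

/-- Shifting by `θ` shifts the spectrum, so `S - θ` has nonnegative eigenvalues and is positive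
semidefinite. -/
theorem lambdaMin_mul_le_inner {ι : Type*} [Fintype ι] [DecidableEq ι] {S : Matrix ι ι ℝ}
    (hS : Sᵀ = S) {θ : ℝ} (hθ : θ ≤ lambdaMin S) (y : EuclideanSpace ℝ ι) :
    θ * ‖y‖ ^ 2 ≤ inner ℝ y (ap S y) := by
  have hH : (S - algebraMap ℝ (Matrix ι ι ℝ) θ).IsHermitian := by
    rw [Matrix.IsHermitian, Matrix.conjTranspose_eq_transpose_of_trivial, Matrix.transpose_sub, hS,
      Matrix.algebraMap_eq_diagonal, Matrix.diagonal_transpose]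
  have hps : (S - algebraMap ℝ (Matrix ι ι ℝ) θ).PosSemidef := by
    refine hH.posSemidef_iff_eigenvalues_nonneg.2 fun i => ?_
    have h1 := hH.eigenvalues_mem_spectrum_real i
    have h2 : hH.eigenvalues i + θ ∈ spectrum ℝ S := by
      rw [spectrum.add_mem_iff]
      convert h1 using 2
      abel
    have h3 : lambdaMin S ≤ hH.eigenvalues i + θ := csInf_le (Matrix.finite_real_spectrum.bddBelow) h2
    simp only [Pi.zero_apply]
    linarith
  have h := hps.dotProduct_mulVec_nonneg y.ofLp
  have e1 : inner ℝ y (ap S y) = y.ofLp ⬝ᵥ (S *ᵥ y.ofLp) := by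
    rw [EuclideanSpace.inner_eq_star_dotProduct]
    simp [ap, dotProduct_comm]
  have e2 : ‖y‖ ^ 2 = y.ofLp ⬝ᵥ y.ofLp := by
    rw [← real_inner_self_eq_norm_sq, EuclideanSpace.inner_eq_star_dotProduct]
    simp
  rw [e1, e2]
  simp only [star_trivial, Matrix.sub_mulVec, dotProduct_sub, Matrix.algebraMap_eq_diagonal] at h
  have e3 : Matrix.diagonal (algebraMap ℝ (ι → ℝ) θ) *ᵥ y.ofLp = θ • y.ofLp := by
    ext i
    simp [Matrix.mulVec_diagonal]
  rw [e3, dotProduct_smul, smul_eq_mul] at h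
  linarith

/-! ### Entrywise conditional expectations -/

section CondExp
variable {Ω : Type*} {m : MeasurableSpace Ω} [mΩ : MeasurableSpace Ω] {ι κ : Type*}

variable (m) in
/-- `W` is a version of the entrywise conditional expectation of the integrable matrix `Z`. -/
def IsCondExp (μ : Measure Ω) (Z W : Ω → Matrix ι κ ℝ) : Prop :=
  ∀ i j, Integrable (fun ω => Z ω i j) μ ∧
    (fun ω => W ω i j) =ᵐ[μ] μ[fun ω => Z ω i j|m]

variable {μ : Measure Ω} {Z Z' W W' : Ω → Matrix ι κ ℝ}

theorem isCondExp_condExpMat (h : ∀ i j, Integrable (fun ω => Z ω i j) μ) :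
    IsCondExp m μ Z (condExpMat μ m Z) := fun i j => ⟨h i j, ae_eq_rfl⟩

theorem IsCondExp.add (h : IsCondExp m μ Z W) (h' : IsCondExp m μ Z' W') :
    IsCondExp m μ (fun ω => Z ω + Z' ω) fun ω => W ω + W' ω := fun i j =>
  ⟨(h i j).1.add (h' i j).1,
    ((h i j).2.add (h' i j).2).trans (condExp_add (h i j).1 (h' i j).1 m).symm⟩

theorem IsCondExp.sub (h : IsCondExp m μ Z W) (h' : IsCondExp m μ Z' W') :
    IsCondExp m μ (fun ω => Z ω - Z' ω) fun ω => W ω - W' ω := fun i j =>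
  ⟨(h i j).1.sub (h' i j).1,
    ((h i j).2.sub (h' i j).2).trans (condExp_sub (h i j).1 (h' i j).1 m).symm⟩

theorem IsCondExp.smul (c : ℝ) (h : IsCondExp m μ Z W) :
    IsCondExp m μ (fun ω => c • Z ω) fun ω => c • W ω := fun i j =>
  ⟨(h i j).1.const_mul c,
    ((h i j).2.const_smul c).trans (condExp_smul c (fun ω => Z ω i j) m).symm⟩

theorem IsCondExp.zero : IsCondExp m μ (fun _ => (0 : Matrix ι κ ℝ)) fun _ => 0 := fun i j =>
  ⟨integrable_zero _ _ _, by
    have h : μ[(0 : Ω → ℝ)|m] = 0 := condExp_zero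
    exact Filter.EventuallyEq.of_eq h.symm⟩

theorem IsCondExp.sum {α : Type*} (s : Finset α) {Y V : α → Ω → Matrix ι κ ℝ}
    (h : ∀ a ∈ s, IsCondExp m μ (Y a) (V a)) :
    IsCondExp m μ (fun ω => ∑ a ∈ s, Y a ω) fun ω => ∑ a ∈ s, V a ω := by
  classical
  induction s using Finset.induction_on with
  | empty => simpa using IsCondExp.zero
  | insert a s ha ih =>
    simp only [Finset.sum_insert ha]
    exact (h a (Finset.mem_insert_self a s)).add
      (ih fun b hb => h b (Finset.mem_insert_of_mem hb))

theorem IsCondExp.kronecker_one {γ : Type*} [DecidableEq γ] (h : IsCondExp m μ Z W) :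
    IsCondExp m μ (fun ω => Z ω ⊗ₖ (1 : Matrix γ γ ℝ)) fun ω => W ω ⊗ₖ (1 : Matrix γ γ ℝ) := by
  intro i j
  have := (h.smul ((1 : Matrix γ γ ℝ) i.2 j.2)) i.1 j.1
  simpa only [Matrix.smul_apply, smul_eq_mul, mul_comm, Matrix.kroneckerMap_apply] using this

/-- In coordinates the form is a sum of `f_i f_j Z_ij`, and the `m`-measurable factor `f_i f_j` can
be pulled out. It is merely integrable, hence the boundedness of `Z`. -/
theorem IsCondExp.integral_inner_ap [IsProbabilityMeasure μ] [Fintype ι] (hm : m ≤ mΩ)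
    {Z W : Ω → Matrix ι ι ℝ} (h : IsCondExp m μ Z W) {c : ℝ}
    (hbd : ∀ᵐ ω ∂μ, ∀ i j, |Z ω i j| ≤ c) {f : Ω → EuclideanSpace ℝ ι} (hf : Measurable[m] f)
    (hf2 : MemLp f 2 μ) :
    Integrable (fun ω => inner ℝ (f ω) (ap (W ω) (f ω))) μ ∧
    ∫ ω, inner ℝ (f ω) (ap (W ω) (f ω)) ∂μ = ∫ ω, inner ℝ (f ω) (ap (Z ω) (f ω)) ∂μ := by
  have hcoord : ∀ i, MemLp (fun ω => f ω i) 2 μ := fun i =>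
    hf2.of_le ((EuclideanSpace.proj (𝕜 := ℝ) i).continuous.comp_aestronglyMeasurable hf2.1)
      (ae_of_all _ fun ω => PiLp.norm_apply_le (f ω) i)
  have hexp : ∀ (Y : Ω → Matrix ι ι ℝ) ω, inner ℝ (f ω) (ap (Y ω) (f ω)) =
      ∑ i, ∑ j, (f ω i * f ω j) * Y ω i j := by
    intro Y ω
    simp only [PiLp.inner_apply, ap_apply, RCLike.inner_apply, conj_trivial, Finset.sum_mul]
    exact Finset.sum_congr rfl fun i _ => Finset.sum_congr rfl fun j _ => by ring
  have hff : ∀ i j, Integrable (fun ω => f ω i * f ω j) μ := fun i j =>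
    (hcoord i).integrable_mul (hcoord j)
  have hZ : ∀ i j, Integrable (fun ω => (f ω i * f ω j) * Z ω i j) μ := fun i j =>
    (hff i j).mul_bdd (c := c) (h i j).1.1 (hbd.mono fun ω hω => hω i j)
  have hpull : ∀ i j, (fun ω => (f ω i * f ω j) * W ω i j) =ᵐ[μ]
      μ[fun ω => (f ω i * f ω j) * Z ω i j|m] := by
    intro i j
    have h1 : μ[fun ω => (f ω i * f ω j) * Z ω i j|m] =ᵐ[μ]
        (fun ω => f ω i * f ω j) * μ[fun ω => Z ω i j|m] := condExp_mul_of_stronglyMeasurable_left (m := m) (μ := μ)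
      ((measurable_coord hf i).mul (measurable_coord hf j)).stronglyMeasurable (hZ i j) (h i j).1
    filter_upwards [h1, (h i j).2] with ω h2 h3
    rw [h2, Pi.mul_apply, ← h3]
  have hW : ∀ i j, Integrable (fun ω => (f ω i * f ω j) * W ω i j) μ := fun i j =>
    integrable_condExp.congr (hpull i j).symm
  simp only [hexp]
  refine ⟨integrable_finsetSum _ fun i _ => integrable_finsetSum _ fun j _ => hW i j, ?_⟩
  rw [integral_finsetSum _ fun i _ => integrable_finsetSum _ fun j _ => hW i j,
    integral_finsetSum _ fun i _ => integrable_finsetSum _ fun j _ => hZ i j]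
  refine Finset.sum_congr rfl fun i _ => ?_
  rw [integral_finsetSum _ fun j _ => hW i j]
  refine Eq.trans ?_ (integral_finsetSum _ fun j _ => hZ i j).symm
  refine Finset.sum_congr rfl fun j _ => ?_
  rw [integral_congr_ae (hpull i j), integral_condExp hm]

end CondExp

namespace Network

variable {Ω : Type*} [mΩ : MeasurableSpace Ω] {μ : Measure Ω} {N n d : ℕ} {M : Network Ω μ N n d}
variable {K : ℝ} {x : Fin N → ℤ → Ω → EuclideanSpace ℝ (Fin n)}

/-! ### Excitation as a lower bound for the mean quadratic forms -/

section Excitation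
open scoped Matrix.Norms.L2Operator

theorem kronecker_one_transpose {α γ : Type*} [DecidableEq γ] (Y : Matrix α α ℝ) :
    (Y ⊗ₖ (1 : Matrix γ γ ℝ))ᵀ = Yᵀ ⊗ₖ (1 : Matrix γ γ ℝ) := by
  ext i j
  simp [Matrix.one_apply, eq_comm]

/-- Entrywise conditioning commutes with transposition by definition, which exchanges the two delay
sums. The symmetry holds at every `ω`. -/
theorem excMat_transpose (h m : ℕ) (ω : Ω) : (M.excMat h m ω)ᵀ = M.excMat h m ω := by
  have e1 : ∀ k l, (condExpMat μ (M.sigmaF l) (M.symLap k) ω)ᵀ = condExpMat μ (M.sigmaF l) (M.symLap k) ω := by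
    intro k l
    have : M.symLap k = fun ω => (M.symLap k ω)ᵀ := by
      funext ω
      simp [symLap, add_comm]
    conv_rhs => rw [this]
    rfl
  have e2 : ∀ k l, (condExpMat μ (M.sigmaF l) (fun ω' => (M.calH k ω')ᵀ * M.calH k ω') ω)ᵀ =
      condExpMat μ (M.sigmaF l) (fun ω' => (M.calH k ω')ᵀ * M.calH k ω') ω := by
    intro k l
    have : (fun ω' => (M.calH k ω')ᵀ * M.calH k ω') =
        fun ω => ((M.calH k ω)ᵀ * M.calH k ω)ᵀ := by
      funext ω
      simp
    conv_rhs => rw [this]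
    rfl
  have e3 : ∀ k q l, (condExpMat μ (M.sigmaF l) (M.delayTerm k q) ω)ᵀ =
      condExpMat μ (M.sigmaF l) (fun ω' => (M.delayTerm k q ω')ᵀ) ω := fun k q l => rfl
  have e4 : ∀ k q l, (condExpMat μ (M.sigmaF l) (fun ω' => (M.delayTerm k q ω')ᵀ) ω)ᵀ =
      condExpMat μ (M.sigmaF l) (M.delayTerm k q) ω := fun k q l => rfl
  simp only [excMat, Matrix.transpose_sum, Matrix.transpose_sub, Matrix.transpose_add,
    Matrix.transpose_smul, kronecker_one_transpose, e1, e2, e3, e4]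
  exact Finset.sum_congr rfl fun k _ => sub_right_comm _ _ _

theorem norm_inv_prodFrom_le {ι : Type*} [Fintype ι] [DecidableEq ι] {Z : ℤ → Matrix ι ι ℝ}
    {c : ℝ} (h0 : 0 ≤ c) (hZ : ∀ j, ‖(Z j)⁻¹‖ ≤ c) (i : ℤ) (l : ℕ) :
    ‖(prodFrom Z i l)⁻¹‖ ≤ c ^ l := by
  induction l with
  | zero => simpa [prodFrom] using l2_opNorm_one_le
  | succ l ih =>
    rw [prodFrom, Matrix.mul_inv_rev, pow_succ]
    exact (norm_mul_le _ _).trans (mul_le_mul ih (hZ _) (norm_nonneg _) (by positivity))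

theorem _root_.DistEst.MeasMat.integrable_entry [IsFiniteMeasure μ] {ι κ : Type*} {Z : Ω → Matrix ι κ ℝ}
    (hZ : MeasMat mΩ Z) {c : ℝ} (hbd : ∀ᵐ ω ∂μ, ∀ i j, |Z ω i j| ≤ c) (i : ι) (j : κ) :
    Integrable (fun ω => Z ω i j) μ :=
  Integrable.of_bound (hZ i j).aestronglyMeasurable c (hbd.mono fun _ h => h i j)

theorem measMat_symLap (k : ℕ) : MeasMat mΩ (M.symLap k) := by
  have hL : MeasMat mΩ (M.lap k) :=
    ((M.measMat_degMat k).sub (M.measMat_A k)).mono (M.sigmaEnv_le k)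
  exact (hL.add hL.transpose).smul _

theorem measMat_excTerm (k : ℕ) : MeasMat mΩ (M.excTerm k) := by
  have hH := (M.measMat_calH k).mono (M.sigmaEnv_le k)
  have hD := fun q => (M.measMat_delayTerm k q).mono M.sigmaEnvAll_le
  exact ((((measMat_symLap k).kronecker_one.smul _).add ((hH.transpose.mul hH).smul _)).sub
    ((MeasMat.sum _ fun q _ => hD q).smul _)).sub ((MeasMat.sum _ fun q _ => (hD q).transpose).smul _)

/-- Linearity of conditional expectation; what needs proof is that all entries are bounded, hence
integrable. -/
theorem Regular.isCondExp_excMat [IsProbabilityMeasure μ] (hr : M.Regular K) (h m : ℕ) :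
    IsCondExp (M.sigmaF (((m * h : ℕ) : ℤ) - 1)) μ
      (fun ω => ∑ k ∈ Finset.Ico (m * h) ((m + 1) * h), M.excTerm k ω) (M.excMat h m) := by
  have h0 : 0 ≤ K := zero_le_one.trans hr.one_le
  refine IsCondExp.sum _ fun k _ => ?_
  have hL : ∀ i j, Integrable (fun ω => M.symLap k ω i j) μ := by
    refine MeasMat.integrable_entry (measMat_symLap k) (c := N * K + K) ?_
    filter_upwards [hr.abs_A] with ω hA i j
    have hlap : ∀ i j, |M.lap k ω i j| ≤ N * K + K := by
      intro i j
      rw [lap, Matrix.sub_apply]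
      refine (abs_sub _ _).trans (add_le_add ?_ (hA k i j))
      rw [degMat, Matrix.diagonal_apply]
      split_ifs
      · refine (Finset.abs_sum_le_sum_abs _ _).trans ?_
        refine (Finset.sum_le_sum fun j _ => hA k i j).trans ?_
        simp
      · simp only [abs_zero]; positivity
    have e : M.symLap k ω i j = (M.lap k ω i j + M.lap k ω j i) / 2 := by
      simp [symLap]; ring
    rw [e, abs_le]
    have h1 := abs_le.1 (hlap i j)
    have h2 := abs_le.1 (hlap j i)
    constructor <;> linarith
  have hHH : ∀ i j, Integrable (fun ω => ((M.calH k ω)ᵀ * M.calH k ω) i j) μ := by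
    have hH := (M.measMat_calH k).mono (M.sigmaEnv_le k)
    refine MeasMat.integrable_entry (hH.transpose.mul hH) (c := K * K) ?_
    filter_upwards [hr.norm_calH] with ω hω i j
    refine (abs_entry_le_l2_opNorm _ i j).trans ((Matrix.l2_opNorm_mul _ _).trans ?_)
    rw [l2_opNorm_transpose]
    exact mul_le_mul (hω k) (hω k) (norm_nonneg _) h0
  have hD : ∀ q i j, Integrable (fun ω => M.delayTerm k q ω i j) μ := by
    intro q
    refine MeasMat.integrable_entry ((M.measMat_delayTerm k q).mono M.sigmaEnvAll_le)
      (c := K * (K ^ ((k : ℤ) - 1 + 1 - ((k : ℤ) - q)).toNat + 1)) ?_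
    filter_upwards [hr.norm_Abar, hr.norm_inv_F] with ω hA hF i j
    refine (abs_entry_le_l2_opNorm _ i j).trans ((norm_mul_le _ _).trans ?_)
    refine mul_le_mul (hA k q) ((norm_sub_le _ _).trans ?_) (norm_nonneg _) h0
    exact add_le_add (norm_inv_prodFrom_le h0 hF _ _) l2_opNorm_one_le
  exact ((((isCondExp_condExpMat hL).kronecker_one.smul _).add
    ((isCondExp_condExpMat hHH).smul _)).sub
    ((IsCondExp.sum _ fun q _ => isCondExp_condExpMat (hD q)).smul _)).sub
    ((IsCondExp.sum _ fun q _ => isCondExp_condExpMat fun i j => hD q j i).smul _)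

variable (M) in
/-- Mean quadratic form of `I - F(k)`. -/
noncomputable def quad (k : ℕ) (f : Ω → EuclideanSpace ℝ (Fin N × Fin n)) : ℝ :=
  ∫ ω, inner ℝ (f ω) (ap (1 - M.F k ω) (f ω)) ∂μ

theorem Regular.memLp_one_sub_F (hr : M.Regular K) (hb : ∀ k, 0 ≤ M.b k) (k : ℕ)
    {f : Ω → EuclideanSpace ℝ (Fin N × Fin n)} (hf : MemLp f 2 μ) :
    MemLp (fun ω => ap (1 - M.F k ω) (f ω)) 2 μ ∧
      lpNorm (fun ω => ap (1 - M.F k ω) (f ω)) 2 μ ≤ K * M.b k * lpNorm f 2 μ :=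
  (measMat_one_sub_F (k : ℤ)).memLp_ap (mul_nonneg (zero_le_one.trans hr.one_le) (hb k))
    (hr.norm_one_sub_F.mono fun _ h => h k) hf

theorem Regular.abs_quad_le (hr : M.Regular K) (hb : ∀ k, 0 ≤ M.b k) (k : ℕ)
    {f : Ω → EuclideanSpace ℝ (Fin N × Fin n)} (hf : MemLp f 2 μ) :
    |M.quad k f| ≤ K * M.b k * lpNorm f 2 μ ^ 2 := by
  have h := hr.memLp_one_sub_F hb k hf
  refine (abs_integral_inner_le hf h.1).trans ?_
  have := mul_le_mul_of_nonneg_left h.2 (lpNorm_nonneg (f := f) (p := 2) (μ := μ))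
  linarith

/-- With `G = I - F(k)`, split `⟨f, G f⟩ - ⟨g, G g⟩ = ⟨f - g, G f⟩ + ⟨g, G (f - g)⟩`. -/
theorem Regular.abs_quad_sub_le (hr : M.Regular K) (hb : ∀ k, 0 ≤ M.b k) (k : ℕ)
    {f g : Ω → EuclideanSpace ℝ (Fin N × Fin n)} (hf : MemLp f 2 μ) (hg : MemLp g 2 μ) :
    |M.quad k f - M.quad k g| ≤
      K * M.b k * lpNorm (fun ω => f ω - g ω) 2 μ * (lpNorm f 2 μ + lpNorm g 2 μ) := by
  have hfg : MemLp (fun ω => f ω - g ω) 2 μ := hf.sub hg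
  have h1 := hr.memLp_one_sub_F hb k hf
  have h2 := hr.memLp_one_sub_F hb k hg
  have h3 := hr.memLp_one_sub_F hb k hfg
  have e : M.quad k f - M.quad k g = (∫ ω, inner ℝ (f ω - g ω) (ap (1 - M.F k ω) (f ω)) ∂μ)
      + ∫ ω, inner ℝ (g ω) (ap (1 - M.F k ω) (f ω - g ω)) ∂μ := by
    rw [quad, quad, ← integral_sub (integrable_inner_of_memLp hf h1.1)
      (integrable_inner_of_memLp hg h2.1), ← integral_add (integrable_inner_of_memLp hfg h1.1)
      (integrable_inner_of_memLp hg h3.1)]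
    refine integral_congr_ae (ae_of_all _ fun ω => ?_)
    simp only [ap_sub, inner_sub_left, inner_sub_right]
    ring
  rw [e]
  refine (abs_add_le _ _).trans ?_
  have a1 := (abs_integral_inner_le hfg h1.1).trans (mul_le_mul_of_nonneg_left h1.2 lpNorm_nonneg)
  have a2 := (abs_integral_inner_le hg h3.1).trans (mul_le_mul_of_nonneg_left h3.2 lpNorm_nonneg)
  linarith

/-- Over a time interval, the conditional excitation bounds the mean quadratic forms from below. -/
theorem Regular.le_sum_quad [IsProbabilityMeasure μ] (hr : M.Regular K)
    (ha : ∀ k, 0 < M.a k) (hb : ∀ k, 0 ≤ M.b k) (haanti : Antitone M.a) (hbanti : Antitone M.b)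
    {h : ℕ} {θ : ℝ} (hexc : ∀ᵐ ω ∂μ, ∀ m : ℕ, θ ≤ M.excitation h m ω) (m : ℕ)
    {f : Ω → EuclideanSpace ℝ (Fin N × Fin n)} (hf2 : MemLp f 2 μ)
    (hf : Measurable[M.sigmaF (((m * h : ℕ) : ℤ) - 1)] f) :
    (θ * M.a ((m + 1) * h) - 2 * K * h * (M.b (m * h) * (1 - M.a ((m + 1) * h) / M.a (m * h))))
      * lpNorm f 2 μ ^ 2 ≤ 2 * ∑ k ∈ Finset.Ico (m * h) ((m + 1) * h), M.quad k f := by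
  have h0 : 0 ≤ K := zero_le_one.trans hr.one_le
  set Y := lpNorm f 2 μ ^ 2 with hY
  have hY0 : 0 ≤ Y := sq_nonneg _
  set I := Finset.Ico (m * h) ((m + 1) * h) with hI
  have hE : ∀ k, M.a k * ∫ ω, inner ℝ (f ω) (ap (M.excTerm k ω) (f ω)) ∂μ = 2 * M.quad k f := by
    intro k
    rw [quad, ← integral_const_mul, ← integral_const_mul]
    refine integral_congr_ae (ae_of_all _ fun ω => ?_)
    simp only
    rw [← real_inner_smul_right, ← smul_ap, M.smul_excTerm k ω (ha k).ne', add_ap, inner_add_right,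
      ← inner_ap_left, real_inner_comm (f ω), two_mul]
  have hnormE : ∀ k, ∀ᵐ ω ∂μ, ‖M.excTerm k ω‖ ≤ 2 * K * (M.b k / M.a k) := by
    intro k
    filter_upwards [hr.norm_one_sub_F] with ω hG
    have e : M.excTerm k ω = (M.a k)⁻¹ • ((1 - M.F k ω) + (1 - M.F k ω)ᵀ) := by
      rw [← M.smul_excTerm k ω (ha k).ne', smul_smul, inv_mul_cancel₀ (ha k).ne', one_smul]
    rw [e, norm_smul, norm_inv, Real.norm_of_nonneg (ha k).le]
    have h1 : ‖(1 - M.F k ω) + (1 - M.F k ω)ᵀ‖ ≤ K * M.b k + K * M.b k := by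
      refine (norm_add_le _ _).trans ?_
      rw [l2_opNorm_transpose]
      exact add_le_add (hG k) (hG k)
    calc (M.a k)⁻¹ * ‖(1 - M.F k ω) + (1 - M.F k ω)ᵀ‖ ≤ (M.a k)⁻¹ * (K * M.b k + K * M.b k) :=
          mul_le_mul_of_nonneg_left h1 (inv_nonneg.2 (ha k).le)
      _ = _ := by field_simp; ring
  have hEint : ∀ k, Integrable (fun ω => inner ℝ (f ω) (ap (M.excTerm k ω) (f ω))) μ := fun k =>
    integrable_inner_of_memLp hf2 ((measMat_excTerm k).memLp_ap
      (mul_nonneg (mul_nonneg zero_le_two h0) (div_nonneg (hb k) (ha k).le)) (hnormE k) hf2).1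
  have hsum : θ * Y ≤ ∑ k ∈ I, ∫ ω, inner ℝ (f ω) (ap (M.excTerm k ω) (f ω)) ∂μ := by
    have hbd : ∀ᵐ ω ∂μ, ∀ i j, |(∑ k ∈ I, M.excTerm k ω) i j| ≤
        ∑ k ∈ I, 2 * K * (M.b k / M.a k) := by
      filter_upwards [ae_all_iff.2 hnormE] with ω hω i j
      exact (abs_entry_le_l2_opNorm _ i j).trans
        ((norm_sum_le _ _).trans (Finset.sum_le_sum fun k _ => hω k))
    obtain ⟨hint, heq⟩ := (hr.isCondExp_excMat h m).integral_inner_ap (M.sigmaF_le _) hbd hf hf2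
    have e : ∀ ω, inner ℝ (f ω) (ap (∑ k ∈ I, M.excTerm k ω) (f ω)) =
        ∑ k ∈ I, inner ℝ (f ω) (ap (M.excTerm k ω) (f ω)) := by
      intro ω
      simp only [ap, Matrix.sum_mulVec, WithLp.toLp_sum, inner_sum]
    rw [← integral_finsetSum _ fun k _ => hEint k]
    simp only [← e]
    rw [← heq, hY, sq_lpNorm_two hf2, ← integral_const_mul]
    refine integral_mono_ae (hf2.norm.integrable_sq.const_mul θ) hint ?_
    filter_upwards [hexc] with ω hω
    exact lambdaMin_mul_le_inner (excMat_transpose h m ω) (hω m) (f ω)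
  -- A single form may be negative, so lowering its weight from `a(k)` to the value at the block end
  -- is not free. The discrepancy is `1 - a((m+1)h) / a(k)` times `2 quad`, and `quad` is `O(b)`.
  have hterm : ∀ k ∈ I, M.a ((m + 1) * h) * (∫ ω, inner ℝ (f ω) (ap (M.excTerm k ω) (f ω)) ∂μ)
      - 2 * K * (M.b (m * h) * (1 - M.a ((m + 1) * h) / M.a (m * h))) * Y ≤ 2 * M.quad k f := by
    intro k hk
    have hk := Finset.mem_Ico.1 hk
    have hq := hr.abs_quad_le hb k hf2
    set E := ∫ ω, inner ℝ (f ω) (ap (M.excTerm k ω) (f ω)) ∂μ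
    set ae := M.a ((m + 1) * h)
    have hr1 : ae / M.a k ≤ 1 := (div_le_one (ha k)).2 (haanti hk.2.le)
    have hr2 : ae / M.a (m * h) ≤ ae / M.a k :=
      div_le_div_of_nonneg_left (ha _).le (ha k) (haanti hk.1)
    have e : ae * E = ae / M.a k * (2 * M.quad k f) := by
      rw [← hE k, ← mul_assoc, div_mul_cancel₀ _ (ha k).ne']
    have h2 : -(2 * M.quad k f) ≤ 2 * K * M.b (m * h) * Y := by
      have h3 : K * M.b k * Y ≤ K * M.b (m * h) * Y :=
        mul_le_mul_of_nonneg_right (mul_le_mul_of_nonneg_left (hbanti hk.1) h0) hY0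
      linarith [(abs_le.1 hq).1]
    have hB : 0 ≤ 2 * K * M.b (m * h) * Y := by
      have := hb (m * h)
      positivity
    rw [e]
    have h4 := mul_le_mul_of_nonneg_left h2 (sub_nonneg.2 hr1)
    have h5 := mul_le_mul_of_nonneg_right (sub_le_sub_left hr2 1) hB
    linarith
  have hcard : (I.card : ℝ) = h := by
    rw [hI, Nat.card_Ico, add_mul, one_mul, Nat.add_sub_cancel_left]
  have := Finset.sum_le_sum hterm
  rw [Finset.sum_sub_distrib, ← Finset.mul_sum, ← Finset.mul_sum, Finset.sum_const, nsmul_eq_mul,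
    hcard, ← Finset.mul_sum] at this
  have h6 := mul_le_mul_of_nonneg_left hsum (ha ((m + 1) * h)).le
  linarith

end Excitation
end Network
end DistEst

namespace DistEst
namespace Network

variable {Ω : Type*} [mΩ : MeasurableSpace Ω] {μ : Measure Ω} {N n d : ℕ} {M : Network Ω μ N n d}
variable {K : ℝ} {x : Fin N → ℤ → Ω → EuclideanSpace ℝ (Fin n)}

/-! ### Mean square energy estimates and convergence -/

section Energy
open scoped Matrix.Norms.L2Operator

theorem mul_le_sq_add (s t : ℝ) : t * s ≤ (s + t) ^ 2 := by
  nlinarith [sq_nonneg (s + t), sq_nonneg s, sq_nonneg t]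

/-- One step of the error in mean square. -/
theorem Regular.exists_one_step [IsProbabilityMeasure μ] (hr : M.Regular K) (hx : M.IsEstimate x)
    (h1a : M.A1a) {βv : ℝ} (h1b : M.A1b βv) (h3a : M.A3a) :
    ∃ D, 0 ≤ D ∧ ∀ k : ℕ, d ≤ k →
      lpNorm (fun ω => M.err x ((k : ℤ) + 1) ω - M.err x k ω) 2 μ
        ≤ D * (M.b k * lpNorm (M.err x k) 2 μ + M.a k) ∧
      lpNorm (M.err x ((k : ℤ) + 1)) 2 μ ^ 2 ≤ lpNorm (M.err x k) 2 μ ^ 2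
        - 2 * M.quad k (M.err x k) + D * (M.b k * lpNorm (M.err x k) 2 μ + M.a k) ^ 2 := by
  obtain ⟨K₁, hK₁, hw⟩ := hr.exists_lpNorm_devDelay_le hx h3a
  obtain ⟨ha, hb, -, hbanti, -⟩ := h3a
  have h0 : 0 ≤ K := zero_le_one.trans hr.one_le
  -- Bounds delayed part plus noise by `K₂ a(k)`, using `a b ≤ b(0) a` for the former.
  set K₂ := K₁ * M.b 0 + K * K with hK₂
  have hb0 := (hb 0).le
  have hK₂0 : 0 ≤ K₂ := by positivity
  refine ⟨K + K₂ + (2 * K * K₁ + K₂ ^ 2 + K ^ 2), by positivity, fun k hk => ?_⟩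
  set e : Ω → EuclideanSpace ℝ (Fin N × Fin n) := M.err x k with he
  set y := lpNorm e 2 μ with hy
  have hy0 : 0 ≤ y := lpNorm_nonneg
  set w := M.devDelay x k with hwdef
  set g : Ω → EuclideanSpace ℝ (Fin N × Fin n) := fun ω => ap (M.calH k ω)ᵀ (M.v k ω) with hg
  set Ge : Ω → EuclideanSpace ℝ (Fin N × Fin n) := fun ω => ap (1 - M.F k ω) (e ω) with hGe
  set Fe : Ω → EuclideanSpace ℝ (Fin N × Fin n) := fun ω => ap (M.F k ω) (e ω) with hFe
  have he2 : MemLp e 2 μ := hr.memLp_err hx k (by omega)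
  have hw2 : MemLp w 2 μ := (hr.memLp_devDelay hx (fun k => (hb k).le) k).1
  obtain ⟨hg2, hgn⟩ := hr.memLp_calH_v k
  obtain ⟨hGe2, hGen⟩ := hr.memLp_one_sub_F (fun k => (hb k).le) k he2
  obtain ⟨hFe2, hFen⟩ := (measMat_F_ambient (M := M) (k : ℤ)).memLp_ap h0
    (hr.norm_F.mono fun _ h => h (k : ℤ)) he2
  set r : Ω → EuclideanSpace ℝ (Fin N × Fin n) := fun ω => w ω + M.a k • g ω with hrdef
  have hag2 : MemLp (fun ω => M.a k • g ω) 2 μ := hg2.const_smul (M.a k)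
  have hr2 : MemLp r 2 μ := hw2.add hag2
  have hak := ha k
  have hbk := hb k
  have hrn : lpNorm r 2 μ ≤ K₂ * M.a k := by
    have h1 : lpNorm r 2 μ ≤ lpNorm w 2 μ + lpNorm (M.a k • g) 2 μ := lpNorm_add_le hw2 (by norm_num)
    rw [lpNorm_const_smul, coe_nnnorm, Real.norm_of_nonneg hak.le] at h1
    have h2 := hw k hk
    have h3 := mul_le_mul_of_nonneg_left (hbanti (Nat.zero_le k)) (mul_nonneg hK₁ hak.le)
    have h4 := mul_le_mul_of_nonneg_left hgn hak.le
    rw [hK₂]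
    linarith
  have hsucc : M.err x ((k : ℤ) + 1) =ᵐ[μ] fun ω => Fe ω + r ω := by
    filter_upwards [hr.isUnit_F] with ω hω
    rw [hx.err_succ_eq k ω hω, add_assoc]
  have hFeq : ∀ ω, Fe ω = e ω + -Ge ω := by
    intro ω
    simp only [hFe, hGe, sub_ap, one_ap]
    abel
  have hr0 : 0 ≤ lpNorm r 2 μ := lpNorm_nonneg
  have hG0 : 0 ≤ lpNorm Ge 2 μ := lpNorm_nonneg
  constructor
  · have h1 : (fun ω => M.err x ((k : ℤ) + 1) ω - e ω) =ᵐ[μ] fun ω => r ω - Ge ω := by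
      filter_upwards [hsucc] with ω hω
      rw [hω, hFeq]
      abel
    rw [lpNorm_two_congr h1 (hr2.sub hGe2)]
    have h2 : lpNorm (fun ω => r ω - Ge ω) 2 μ ≤ lpNorm r 2 μ + lpNorm Ge 2 μ :=
      lpNorm_sub_le hr2 (by norm_num)
    have h3 : 0 ≤ (2 * K * K₁ + K₂ ^ 2 + K ^ 2) * (M.b k * y + M.a k) := by positivity
    have h4 : 0 ≤ K * M.a k := by positivity
    have h5 : 0 ≤ K₂ * (M.b k * y) := by positivity
    linarith
  · rw [lpNorm_two_congr hsucc (hFe2.add hr2), sq_lpNorm_two_add hFe2 hr2]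
    have hnegG : MemLp (fun ω => -Ge ω) 2 μ := hGe2.neg
    have hF2 : lpNorm Fe 2 μ ^ 2 = y ^ 2 - 2 * M.quad k e + lpNorm Ge 2 μ ^ 2 := by
      have e1 : Fe = fun ω => e ω + -Ge ω := funext hFeq
      have e2 : lpNorm (fun ω => -Ge ω) 2 μ = lpNorm Ge 2 μ := lpNorm_fun_neg Ge 2 μ
      rw [e1, sq_lpNorm_two_add he2 hnegG, e2, quad]
      simp only [inner_neg_right, integral_neg]
      ring
    -- Moving `𝓗` to the other side leaves `v(k)` against a vector that depends on the environment
    -- and earlier noise only.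
    have horth : ∫ ω, inner ℝ (Fe ω) (g ω) ∂μ = 0 := by
      have e1 : ∀ ω, inner ℝ (Fe ω) (g ω) = inner ℝ (ap (M.calH k ω) (Fe ω)) (M.v k ω) := by
        intro ω
        rw [inner_ap_left (M.calH k ω)]
      simp only [e1]
      refine integral_inner_v_eq_zero h1a h1b k ?_ ?_
      · exact (((M.measMat_calH k).mono (M.sigmaEnv_le k)).memLp_ap h0
          (hr.norm_calH.mono fun _ h => h k) hFe2).1
      · have hle : M.sigmaEnvAll ≤ M.sigmaEnvAll ⊔ M.sigmaNoiseLT k := le_sup_left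
        exact ((M.measMat_calH k).mono ((le_iSup M.sigmaEnv k).trans hle)).measurable_ap
          (((M.measMat_F k).mono hle).measurable_ap
            ((hx.measurable_err k (by omega)).mono (M.sigmaF_le_sup k) le_rfl))
    have hcross : ∫ ω, inner ℝ (Fe ω) (r ω) ∂μ = ∫ ω, inner ℝ (Fe ω) (w ω) ∂μ := by
      have e1 : ∀ ω, inner ℝ (Fe ω) (r ω) = inner ℝ (Fe ω) (w ω) + M.a k * inner ℝ (Fe ω) (g ω) := by
        intro ω
        simp only [hrdef]
        rw [inner_add_right, real_inner_smul_right]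
      simp only [e1]
      rw [integral_add (integrable_inner_of_memLp hFe2 hw2)
        ((integrable_inner_of_memLp hFe2 hg2).const_mul _), integral_const_mul, horth]
      ring
    have hc := (abs_le.1 (abs_integral_inner_le hFe2 hw2)).2
    have hc2 : lpNorm Fe 2 μ * lpNorm w 2 μ ≤ (K * y) * (K₁ * (M.a k * M.b k)) :=
      mul_le_mul hFen (hw k hk) lpNorm_nonneg (by positivity)
    have hGsq : lpNorm Ge 2 μ ^ 2 ≤ (K * M.b k * y) ^ 2 := pow_le_pow_left₀ hG0 hGen 2
    have hrsq : lpNorm r 2 μ ^ 2 ≤ (K₂ * M.a k) ^ 2 := pow_le_pow_left₀ hr0 hrn 2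
    rw [hcross, hF2]
    have q0 : 0 ≤ M.b k * y := by positivity
    have q1 : M.a k * (M.b k * y) ≤ (M.b k * y + M.a k) ^ 2 := mul_le_sq_add _ _
    have q2 : (M.b k * y) ^ 2 ≤ (M.b k * y + M.a k) ^ 2 :=
      pow_le_pow_left₀ q0 (by linarith) 2
    have q3 : M.a k ^ 2 ≤ (M.b k * y + M.a k) ^ 2 := pow_le_pow_left₀ hak.le (by linarith) 2
    have p1 := mul_le_mul_of_nonneg_left q1 (show 0 ≤ 2 * K * K₁ by positivity)
    have p2 := mul_le_mul_of_nonneg_left q2 (show 0 ≤ K ^ 2 by positivity)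
    have p3 := mul_le_mul_of_nonneg_left q3 (show 0 ≤ K₂ ^ 2 by positivity)
    have p4 : 0 ≤ (K + K₂) * (M.b k * y + M.a k) ^ 2 := by positivity
    linarith

/-- Several steps of the error in mean square, in terms of the error at the first time. -/
theorem Regular.exists_multi_step [IsProbabilityMeasure μ] (hr : M.Regular K) (hx : M.IsEstimate x)
    (h1a : M.A1a) {βv : ℝ} (h1b : M.A1b βv) (h3a : M.A3a) (l : ℕ) :
    ∃ D, 0 ≤ D ∧ ∀ k : ℕ, d ≤ k →
      lpNorm (fun ω => M.err x ((k + l : ℕ) : ℤ) ω - M.err x k ω) 2 μ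
        ≤ D * (M.b k * lpNorm (M.err x k) 2 μ + M.a k) ∧
      lpNorm (M.err x ((k + l : ℕ) : ℤ)) 2 μ ^ 2 ≤ lpNorm (M.err x k) 2 μ ^ 2
        - 2 * ∑ j ∈ Finset.Ico k (k + l), M.quad j (M.err x k)
        + D * (M.b k * lpNorm (M.err x k) 2 μ + M.a k) ^ 2 := by
  obtain ⟨C, hC, hstep⟩ := hr.exists_one_step hx h1a h1b h3a
  obtain ⟨ha, hb, haanti, hbanti, -⟩ := h3a
  have h0 : 0 ≤ K := zero_le_one.trans hr.one_le
  induction l with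
  | zero => exact ⟨0, le_rfl, fun k _ => by simp⟩
  | succ l ih =>
    obtain ⟨D, hD, ih⟩ := ih
    have hB := (hb 0).le
    -- The growth factor of `b y + a` over `l` steps, relative to its value at time `k`.
    set E := 1 + M.b 0 * D with hE
    have hE0 : 0 ≤ E := by positivity
    -- One constant for both claims: `D + C E` for the increment, the bracket for the energy. The
    -- last term in the bracket pays for evaluating the new quadratic form at the error at time `k`.
    refine ⟨D + C * E + (D + C * E ^ 2 + 2 * (K * D * (E + 1))), by positivity, fun k hk => ?_⟩
    obtain ⟨ih1, ih2⟩ := ih k hk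
    obtain ⟨s1, s2⟩ := hstep (k + l) (by omega)
    have hm : ∀ j : ℕ, MemLp (M.err x j) 2 μ := fun j => hr.memLp_err hx j (by omega)
    have ecast : ((k + (l + 1) : ℕ) : ℤ) = ((k + l : ℕ) : ℤ) + 1 := by push_cast; ring
    have hm1 : MemLp (M.err x (((k + l : ℕ) : ℤ) + 1)) 2 μ := hr.memLp_err hx _ (by omega)
    rw [ecast, ← Nat.add_assoc, Finset.sum_Ico_succ_top (by omega)]
    set Y := lpNorm (M.err x k) 2 μ with hY
    set y := lpNorm (M.err x ((k + l : ℕ) : ℤ)) 2 μ with hy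
    set Δ := lpNorm (fun ω => M.err x ((k + l : ℕ) : ℤ) ω - M.err x k ω) 2 μ with hΔ
    have hY0 : 0 ≤ Y := lpNorm_nonneg
    have hy0 : 0 ≤ y := lpNorm_nonneg
    have hΔ0 : 0 ≤ Δ := lpNorm_nonneg
    have hyY : y ≤ Y + Δ := by
      have e1 : M.err x ((k + l : ℕ) : ℤ) =
          M.err x k + fun ω => M.err x ((k + l : ℕ) : ℤ) ω - M.err x k ω := by
        funext ω
        simp
      have := lpNorm_add_le (g := fun ω => M.err x ((k + l : ℕ) : ℤ) ω - M.err x k ω)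
        (hm k) (show (1 : ENNReal) ≤ 2 by norm_num)
      rwa [← e1] at this
    set p := M.b k * Y + M.a k with hp
    have hbk := (hb k).le
    have hak := (ha k).le
    have hbkl := (hb (k + l)).le
    have hakl := (ha (k + l)).le
    have hbb : M.b (k + l) ≤ M.b k := hbanti (by omega)
    have haa : M.a (k + l) ≤ M.a k := haanti (by omega)
    have hb1 : M.b k ≤ M.b 0 := hbanti (Nat.zero_le k)
    have hp0 : 0 ≤ p := by positivity
    have hp1 : M.b (k + l) * y + M.a (k + l) ≤ E * p := by
      have t1 : M.b (k + l) * y ≤ M.b k * (Y + D * p) :=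
        mul_le_mul hbb (hyY.trans (by linarith)) hy0 hbk
      have t2 : M.b k * (D * p) ≤ M.b 0 * (D * p) :=
        mul_le_mul_of_nonneg_right hb1 (by positivity)
      have : E * p = M.b k * Y + M.a k + M.b 0 * (D * p) := by rw [hE, hp]; ring
      linarith
    have hp1nn : 0 ≤ M.b (k + l) * y + M.a (k + l) := by positivity
    constructor
    · have e1 : (fun ω => M.err x (((k + l : ℕ) : ℤ) + 1) ω - M.err x k ω) =
          (fun ω => M.err x (((k + l : ℕ) : ℤ) + 1) ω - M.err x ((k + l : ℕ) : ℤ) ω)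
          + fun ω => M.err x ((k + l : ℕ) : ℤ) ω - M.err x k ω := by
        funext ω
        simp
      have hd1 : MemLp (fun ω => M.err x (((k + l : ℕ) : ℤ) + 1) ω
          - M.err x ((k + l : ℕ) : ℤ) ω) 2 μ := hm1.sub (hm (k + l))
      rw [e1]
      refine (lpNorm_add_le hd1 (by norm_num)).trans ?_
      have t1 := mul_le_mul_of_nonneg_left hp1 hC
      have t2 : 0 ≤ (D + C * E ^ 2 + 2 * (K * D * (E + 1))) * p := by positivity
      linarith
    · have hq := (abs_le.1 (hr.abs_quad_sub_le (fun k => (hb k).le) (k + l) (hm (k + l)) (hm k))).1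
      have hq2 : K * M.b (k + l) * Δ * (y + Y) ≤ K * D * (E + 1) * p ^ 2 := by
        have t1 : M.b (k + l) * (y + Y) ≤ (E + 1) * p := by
          have : M.b (k + l) * Y ≤ M.b k * Y := mul_le_mul_of_nonneg_right hbb hY0
          linarith
        have t2 : Δ * (M.b (k + l) * (y + Y)) ≤ (D * p) * ((E + 1) * p) :=
          mul_le_mul ih1 t1 (by positivity) (by positivity)
        have := mul_le_mul_of_nonneg_left t2 h0
        linarith
      have hsq := mul_le_mul_of_nonneg_left (pow_le_pow_left₀ hp1nn hp1 2) hC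
      have t3 : 0 ≤ (D + C * E) * p ^ 2 := by positivity
      linarith

/-- Transfers the divergence of `∑ a` to the subsequence of block times. -/
theorem sum_range_mul_le {a : ℕ → ℝ} (hanti : Antitone a) (h m : ℕ) :
    ∑ k ∈ Finset.range (m * h), a k ≤ h * ∑ j ∈ Finset.range m, a (j * h) := by
  induction m with
  | zero => simp
  | succ m ih =>
    rw [add_mul, one_mul, Finset.sum_range_add, Finset.sum_range_succ, mul_add]
    refine add_le_add ih ?_
    calc ∑ j ∈ Finset.range h, a (m * h + j) ≤ ∑ _j ∈ Finset.range h, a (m * h) :=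
          Finset.sum_le_sum fun j _ => hanti (by omega)
      _ = _ := by simp

/-- The stacked error tends to zero in mean square. -/
theorem Regular.tendsto_lpNorm_err [IsProbabilityMeasure μ] (hr : M.Regular K) (hx : M.IsEstimate x)
    (h1a : M.A1a) {βv : ℝ} (h1b : M.A1b βv) (h3a : M.A3a) {h : ℕ} (hh : 0 < h) {θ : ℝ}
    (hθ : 0 < θ) (hexc : ∀ᵐ ω ∂μ, ∀ m : ℕ, θ ≤ M.excitation h m ω) :
    Tendsto (fun k : ℕ => lpNorm (M.err x k) 2 μ) atTop (𝓝 0) := by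
  have hmulti := hr.exists_multi_step hx h1a h1b h3a
  obtain ⟨R, hR, haR⟩ := h3a.exists_a_le h
  obtain ⟨ha, hb, haanti, hbanti, halim, hblim, -, -, hbo, hasum⟩ := h3a
  have h0 : 0 ≤ K := zero_le_one.trans hr.one_le
  have hh' : (0 : ℝ) < h := by exact_mod_cast hh
  have hsub : Tendsto (fun m : ℕ => m * h) atTop atTop := tendsto_id.atTop_mul_const' hh
  have hsub1 : Tendsto (fun m : ℕ => (m + 1) * h) atTop atTop :=
    hsub.comp (tendsto_add_atTop_nat 1)
  have hmh : ∀ m, m * h + h = (m + 1) * h := fun m => by ring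
  have haR' : ∀ m, M.a (m * h) ≤ R * M.a ((m + 1) * h) := fun m => by
    simpa only [hmh] using haR (m * h)
  obtain ⟨D, hD, hblock⟩ := hmulti h
  set Y : ℕ → ℝ := fun m => lpNorm (M.err x ((m * h : ℕ) : ℤ)) 2 μ with hY
  have hY0 : ∀ m, 0 ≤ Y m := fun m => lpNorm_nonneg
  obtain ⟨C, hC, hbC⟩ := bound_of_isBigO_nat_atTop hbo.isBigO
  have hba : ∀ k, M.b k ≤ √C * √(M.a k) := by
    intro k
    have := hbC (x := k) (ha k).ne'
    rw [Real.norm_of_nonneg (sq_nonneg _), Real.norm_of_nonneg (ha k).le] at this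
    rw [← Real.sqrt_mul hC.le]
    exact Real.le_sqrt_of_sq_le this
  have hYlim2 : Tendsto (fun m => Y m ^ 2) atTop (𝓝 0) := by
    refine tendsto_zero_of_perturbed_contraction (α := fun m => θ / 2 * M.a ((m + 1) * h))
      (η := fun m => 2 * K * h * (M.b (m * h) * (1 - M.a ((m + 1) * h) / M.a (m * h))))
      (β := fun m => 2 * D * M.a (m * h) ^ 2) (fun m => sq_nonneg _) ?_ ?_ ?_ ?_ ?_ ?_ ?_
    · have : Tendsto (fun m : ℕ => θ / 2 * M.a ((m + 1) * h)) atTop (𝓝 0) := by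
        simpa using (halim.comp hsub1).const_mul (θ / 2)
      filter_upwards [this.eventually (gt_mem_nhds (by norm_num : (0 : ℝ) < 1 / 2))] with m hm
      have := ha ((m + 1) * h)
      exact ⟨by positivity, hm.le⟩
    · intro m
      have h1 : M.a ((m + 1) * h) / M.a (m * h) ≤ 1 :=
        (div_le_one (ha _)).2 (haanti (by rw [← hmh]; omega))
      have h2 := hb (m * h)
      have h3 := sub_nonneg.2 h1
      positivity
    · exact (summable_mul_one_sub_div (a := fun m => M.a (m * h)) (b := fun m => M.b (m * h))
        (fun m => ha _) (fun m m' hm => haanti (Nat.mul_le_mul_right h hm)) (fun m => (hb _).le)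
        (Real.sqrt_nonneg C) fun m => hba _).mul_left _
    · have hR0 : 0 < R := by
        have := (ha _).trans_le (haR 0)
        exact pos_of_mul_pos_left this (ha _).le
      have hlow : ∀ m, θ / (2 * h * R) * ∑ k ∈ Finset.range (m * h), M.a k ≤
          ∑ j ∈ Finset.range m, θ / 2 * M.a ((j + 1) * h) := by
        intro m
        have h1 : ∑ j ∈ Finset.range m, M.a (j * h) ≤
            R * ∑ j ∈ Finset.range m, M.a ((j + 1) * h) := by
          rw [Finset.mul_sum]
          exact Finset.sum_le_sum fun j _ => haR' j
        have h2 := (sum_range_mul_le haanti h m).trans (mul_le_mul_of_nonneg_left h1 hh'.le)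
        rw [← Finset.mul_sum]
        calc θ / (2 * h * R) * ∑ k ∈ Finset.range (m * h), M.a k
            ≤ θ / (2 * h * R) * (h * (R * ∑ j ∈ Finset.range m, M.a ((j + 1) * h))) :=
              mul_le_mul_of_nonneg_left h2 (by positivity)
          _ = _ := by field_simp
      exact tendsto_atTop_mono hlow ((hasum.comp hsub).const_mul_atTop (by positivity))
    · intro m
      positivity
    · intro ε hε
      have : Tendsto (fun m : ℕ => 2 * D * R * M.a (m * h)) atTop (𝓝 0) := by
        simpa using (halim.comp hsub).const_mul (2 * D * R)
      filter_upwards [this.eventually (gt_mem_nhds (show 0 < ε * (θ / 2) by positivity))] with m hm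
      have h1 := mul_le_mul_of_nonneg_left (haR' m)
        (show 0 ≤ 2 * D * M.a (m * h) from mul_nonneg (by positivity) (ha _).le)
      have h2 := mul_le_mul_of_nonneg_right hm.le (ha ((m + 1) * h)).le
      linarith
    -- Half of the decrease `θ a` is spent on the `b²` error; the other half is the contraction
    -- rate. The `+ 1`s avoid division by zero.
    · have hsmall : ∀ᶠ m : ℕ in atTop, 2 * D * M.b (m * h) ^ 2 ≤ θ / 2 * M.a ((m + 1) * h) := by
        have h1 := (hbo.comp_tendsto hsub).def
          (show 0 < θ / 2 / ((2 * D + 1) * (R + 1)) by positivity)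
        filter_upwards [h1] with m hm
        simp only [Function.comp_apply, Real.norm_of_nonneg (sq_nonneg (M.b _)),
          Real.norm_of_nonneg (ha _).le] at hm
        have hp := ha ((m + 1) * h)
        calc 2 * D * M.b (m * h) ^ 2 ≤ (2 * D + 1) * M.b (m * h) ^ 2 :=
              mul_le_mul_of_nonneg_right (by linarith) (sq_nonneg _)
          _ ≤ (2 * D + 1) * (θ / 2 / ((2 * D + 1) * (R + 1)) * ((R + 1) * M.a ((m + 1) * h))) := by
              refine mul_le_mul_of_nonneg_left (hm.trans ?_) (by positivity)
              refine mul_le_mul_of_nonneg_left ((haR' m).trans ?_) (by positivity)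
              exact mul_le_mul_of_nonneg_right (by linarith) hp.le
          _ = _ := by field_simp
      filter_upwards [hsmall, hsub.eventually (eventually_ge_atTop d)] with m hm hmd
      obtain ⟨-, hb2⟩ := hblock (m * h) hmd
      have hexc' := hr.le_sum_quad ha (fun k => (hb k).le) haanti hbanti hexc m
        (hr.memLp_err hx ((m * h : ℕ) : ℤ) (by omega)) (hx.measurable_err _ (by omega))
      rw [hmh] at hb2
      have hsq : (M.b (m * h) * Y m + M.a (m * h)) ^ 2 ≤
          2 * M.b (m * h) ^ 2 * Y m ^ 2 + 2 * M.a (m * h) ^ 2 := by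
        nlinarith [sq_nonneg (M.b (m * h) * Y m - M.a (m * h))]
      have h1 := mul_le_mul_of_nonneg_left hsq hD
      have h2 := mul_le_mul_of_nonneg_right hm (sq_nonneg (Y m))
      simp only [hY] at *
      linarith
  have hYlim : Tendsto Y atTop (𝓝 0) := by
    have := hYlim2.sqrt
    simpa [Real.sqrt_sq (hY0 _)] using this
  choose D' hD' hstep using hmulti
  -- One constant for all remainders `k % h`: the error at `k` is compared with that at the last
  -- block time.
  set S := ∑ l ∈ Finset.range h, D' l with hS
  have hz : Tendsto (fun m => Y m + S * (M.b (m * h) * Y m + M.a (m * h))) atTop (𝓝 0) := by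
    simpa using hYlim.add
      ((((hblim.comp hsub).mul hYlim).add (halim.comp hsub)).const_mul S)
  have hdiv : Tendsto (fun k : ℕ => k / h) atTop atTop := Nat.tendsto_div_const_atTop hh.ne'
  refine squeeze_zero' (Eventually.of_forall fun k => lpNorm_nonneg) ?_ (hz.comp hdiv)
  filter_upwards [(hsub.comp hdiv).eventually (eventually_ge_atTop d)] with k hk
  simp only [Function.comp_apply] at hk ⊢
  have ek : k / h * h + k % h = k := by rw [mul_comm]; exact Nat.div_add_mod k h
  have hs := (hstep (k % h) (k / h * h) hk).1
  rw [ek] at hs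
  have hSle : D' (k % h) ≤ S := Finset.single_le_sum (fun l _ => hD' l)
    (Finset.mem_range.2 (Nat.mod_lt k hh))
  have e1 : M.err x k = M.err x ((k / h * h : ℕ) : ℤ) +
      fun ω => M.err x k ω - M.err x ((k / h * h : ℕ) : ℤ) ω := by
    funext ω
    simp
  have h1 := lpNorm_add_le (g := fun ω => M.err x k ω - M.err x ((k / h * h : ℕ) : ℤ) ω)
    (hr.memLp_err hx ((k / h * h : ℕ) : ℤ) (by omega)) (show (1 : ENNReal) ≤ 2 by norm_num)
  rw [← e1] at h1
  have hp : 0 ≤ M.b (k / h * h) * Y (k / h) + M.a (k / h * h) :=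
    add_nonneg (mul_nonneg (hb _).le (hY0 _)) (ha _).le
  exact h1.trans (add_le_add_right (hs.trans (mul_le_mul_of_nonneg_right hSle hp)) _)

theorem norm_sub_le_norm_err (i : Fin N) (k : ℤ) (ω : Ω) :
    ‖x i k ω - M.x₀‖ ≤ ‖M.err x k ω‖ := by
  refine abs_le_of_sq_le_sq' ?_ (norm_nonneg _) |>.2
  rw [EuclideanSpace.norm_sq_eq, EuclideanSpace.norm_sq_eq, Fintype.sum_prod_type]
  exact Finset.single_le_sum (f := fun i => ∑ c, ‖M.err x k ω (i, c)‖ ^ 2)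
    (fun i _ => Finset.sum_nonneg fun c _ => sq_nonneg _) (Finset.mem_univ i)

end Energy
end Network
end DistEst

theorem theorem3 {Ω : Type*} [MeasurableSpace Ω] (μ : Measure Ω) [IsProbabilityMeasure μ]
    (N n d : ℕ) (hd : 0 < d) (M : DistEst.Network Ω μ N n d)
    (x : Fin N → ℤ → Ω → EuclideanSpace ℝ (Fin n)) (hx : M.IsEstimate x)
    (βv βa βH Ca : ℝ) (h1a : M.A1a) (h1b : M.A1b βv) (h2b : M.A2b βa βH) (h3a : M.A3a)
    (h3c : M.A3c βa βH Ca)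
    (h : ℕ) (hh : 0 < h) (θ : ℝ) (hθ : 0 < θ)
    (hexc : ∀ᵐ ω ∂μ, ∀ m : ℕ, θ ≤ M.excitation h m ω) :
    ∀ i : Fin N,
      (∀ k : ℕ, MemLp (fun ω => x i (k : ℤ) ω - M.x₀) 2 μ) ∧
      Tendsto (fun k : ℕ => ∫ ω, ‖x i (k : ℤ) ω - M.x₀‖ ^ 2 ∂μ) atTop (𝓝 0) := by
  intro i
  -- The node `i` itself shows that `N > 0`.
  obtain ⟨K, hr⟩ := DistEst.Network.exists_regular i.pos h1b h2b h3a h3c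
  have hm : ∀ k : ℕ, MemLp (M.err x k) 2 μ := fun k => hr.memLp_err hx k (by omega)
  have hle : ∀ k : ℕ, MemLp (fun ω => x i (k : ℤ) ω - M.x₀) 2 μ ∧
      lpNorm (fun ω => x i (k : ℤ) ω - M.x₀) 2 μ ≤ 1 * lpNorm (M.err x k) 2 μ := by
    intro k
    refine DistEst.lpNorm_le_mul_of_ae ?_ (hm k) zero_le_one
      (ae_of_all _ fun ω => by rw [one_mul]; exact DistEst.Network.norm_sub_le_norm_err i k ω)
    have hmeas := (hx.measurable_err (k : ℤ) (by omega)).mono (M.sigmaF_le _) le_rfl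
    exact (DistEst.measurable_of_coord fun c =>
      DistEst.measurable_coord hmeas (i, c)).aestronglyMeasurable
  refine ⟨fun k => (hle k).1, ?_⟩
  have hlim := (hr.tendsto_lpNorm_err hx h1a h1b h3a hh hθ hexc).pow 2
  rw [zero_pow two_ne_zero] at hlim
  refine squeeze_zero (fun k => integral_nonneg fun ω => sq_nonneg _) (fun k => ?_) hlim
  rw [← DistEst.sq_lpNorm_two (hle k).1]
  exact pow_le_pow_left₀ lpNorm_nonneg (by simpa using (hle k).2) 2
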